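/- \textbf{Theorem.} Let $S$ be a Dedekind domain with field of fractions $L$, let $G$ be a finite group of automorphisms of $S$, and suppose that $R := S^G$ is a discrete valuation ring, with maximal ideal $zR$ and field of fractions $K$. Suppose that $S/R$ is residually separable, i.e. for every maximal ideal $P$ of $S$ the residue field extension $(S/P)/(R/zR)$ is separable. Let $f \colon G\times G \to S^*$ be a $2$-cocycle, and let $T = S^f * G = \bigoplus_{g\in G} S U_g$ be the crossed product, with multiplication $sU_g\, tU_h = s\, g(t) f(g,h)\, U_{gh}$; it is an $R$-subalgebra of the $K$-algebra $L^f*G$. Let $$\widehat R = \varprojlim_i R/z^iR,\qquad \widehat S = \varprojlim_i S/z^iS,\qquad \widehat T = \varprojlim_i T/z^iT ,$$ with the induced action of $G$ on $\widehat S$. Let $e_1$ be a primitive idempotent of $\widehat S$, let $G_1 = \{g\in G : g(e_1) = e_1\}$, and let $T_1 = e_1\widehat T e_1$, where $e_1$ is regarded as an element of $\widehat T$ through $\widehat S\to\widehat T$. For a domain $A$ with field of fractions $F$ and a finite-dimensional $F$-algebra $B$, an $A$-order in $B$ is an $A$-subalgebra $\Lambda$ of $B$ (with the same unit element) that is finitely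 generated as an $A$-module and satisfies $F\Lambda = B$; it is maximal if it is not properly contained in another $A$-order in $B$. Then $T_1 = \widehat S e_1 * G_1$: there is an isomorphism of $\widehat R$-algebras from the crossed product of $G_1$ over $\widehat S e_1$ (with the induced action, and the $2$-cocycle $(g,h)\mapsto f(g,h)e_1$) onto $T_1$ which maps $sU_g$ to $sU_g\in \widehat T$ for all $s\in\widehat S e_1$, $g\in G_1$. Moreover, the following are equivalent: \begin{enumerate} \item $T$ is a maximal $R$-order in $L^f*G$; \item $\widehat T$ is a maximal $\widehat R$-order in $\operatorname{Frac}(\widehat R)\otimes_{\widehat R}\widehat T$; \item $T_1$ is a maximal $\widehat R$-order in $\operatorname{Frac}(\widehat R)\otimes_{\widehat R} T_1$. \end{enumerate} Furthermore, the three rings $T$, $\widehat T$ and $T_1$ have the same, finite, number of maximal two-sided ideals. -/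

import Mathlib

open scoped TensorProduct

noncomputable section

/-! ## Two-cocycles and crossed products -/

/-- A `2`-cocycle of `G` with values in the unit group of the commutative `G`-ring `S`:
`f(g,h) f(gh,j) = g(f(h,j)) f(g,hj)`. No normalization is required. -/
structure TwoCocycle (G S : Type*) [Group G] [CommRing S] [MulSemiringAction G S] where
  val : G → G → Sˣ
  cocycle : ∀ g h j : G,
    (val g h : S) * (val (g * h) j : S) = g • (val h j : S) * (val g (h * j) : S)

namespace TwoCocycle

variable {G S S' : Type*} [Group G] [CommRing S] [MulSemiringAction G S]
  [CommRing S'] [MulSemiringAction G S']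

theorem val_one_left (f : TwoCocycle G S) (g : G) : (f.val 1 g : S) = f.val 1 1 := by
  have h := f.cocycle 1 1 g
  simp only [one_mul, one_smul] at h
  exact ((f.val 1 g).isUnit.mul_left_injective h).symm

theorem val_one_right (f : TwoCocycle G S) (g : G) : (f.val g 1 : S) = g • (f.val 1 1 : S) := by
  have h := f.cocycle g 1 1
  simp only [mul_one] at h
  exact (f.val g 1).isUnit.mul_left_injective h

/-- The image of a cocycle under a `G`-equivariant ring homomorphism. -/
def map (f : TwoCocycle G S) (φ : S →+* S') (hφ : ∀ (g : G) (s : S), φ (g • s) = g • φ s) :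
    TwoCocycle G S' where
  val g h := Units.map (φ : S →* S') (f.val g h)
  cocycle g h j := by
    have := congrArg φ (f.cocycle g h j)
    simpa [hφ] using this

/-- The restriction of a cocycle to a subgroup. -/
def restrict (f : TwoCocycle G S) (H : Subgroup G) : TwoCocycle H S where
  val g h := f.val g h
  cocycle g h j := f.cocycle g h j

end TwoCocycle

/-- The crossed product `S^f * G = ⨁_{g ∈ G} S U_g`, with multiplication
`(s U_g) (t U_h) = s g(t) f(g,h) U_{gh}`. -/
def CrossedProduct {G S : Type*} [Group G] [CommRing S] [MulSemiringAction G S]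
    (_f : TwoCocycle G S) : Type _ := G →₀ S

namespace CrossedProduct

variable {G S : Type*} [Group G] [CommRing S] [MulSemiringAction G S] {f : TwoCocycle G S}

instance : AddCommGroup (CrossedProduct f) := inferInstanceAs (AddCommGroup (G →₀ S))

instance {R : Type*} [CommRing R] [Algebra R S] : Module R (CrossedProduct f) :=
  inferInstanceAs (Module R (G →₀ S))

/-- The element `s U_g` of the crossed product. -/
def single (f : TwoCocycle G S) (g : G) (s : S) : CrossedProduct f := Finsupp.single g s

/-- The `g`-th coefficient of an element of the crossed product, as an additive map. -/
def coeff (f : TwoCocycle G S) (g : G) : CrossedProduct f →+ S := Finsupp.applyAddHom g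

theorem coeff_single (g h : G) (s : S) [Decidable (g = h)] :
    coeff f h (single f g s) = if g = h then s else 0 := by
  classical
  exact Finsupp.single_apply

theorem single_add (g : G) (s t : S) : single f g (s + t) = single f g s + single f g t :=
  Finsupp.single_add g s t

theorem single_zero (g : G) : single f g 0 = 0 := Finsupp.single_zero g

theorem smul_single {R : Type*} [CommRing R] [Algebra R S] (r : R) (g : G) (s : S) :
    r • single f g s = single f g (r • s) := Finsupp.smul_single r g s

@[elab_as_elim]
theorem induction_on {p : CrossedProduct f → Prop} (x : CrossedProduct f) (zero : p 0)
    (single : ∀ g s, p (single f g s)) (add : ∀ x y, p x → p y → p (x + y)) : p x :=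
  Finsupp.induction_linear x zero add single

/-- Multiplication of the crossed product as a biadditive map, on the underlying type of finitely
supported functions. -/
def mulFinsupp (f : TwoCocycle G S) : (G →₀ S) →+ (G →₀ S) →+ (G →₀ S) :=
  Finsupp.liftAddHom fun g =>
    AddMonoidHom.mk' (fun s => Finsupp.liftAddHom fun h =>
        AddMonoidHom.mk' (fun t => Finsupp.single (g * h) (s * g • t * (f.val g h : S)))
          (fun t t' => by rw [← Finsupp.single_add]; congr 1; rw [smul_add]; ring))
      (fun s s' => by
        refine Finsupp.addHom_ext fun h t => ?_
        simp only [AddMonoidHom.add_apply, Finsupp.liftAddHom_apply_single,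
          AddMonoidHom.mk'_apply]
        rw [← Finsupp.single_add]; congr 1; ring)

theorem mulFinsupp_single (f : TwoCocycle G S) (g h : G) (s t : S) :
    mulFinsupp f (Finsupp.single g s) (Finsupp.single h t) =
      Finsupp.single (g * h) (s * g • t * (f.val g h : S)) := by
  simp only [mulFinsupp, Finsupp.liftAddHom_apply_single, AddMonoidHom.mk'_apply]

/-- Multiplication of the crossed product as a biadditive map. -/
def mulHom (f : TwoCocycle G S) :
    CrossedProduct f →+ CrossedProduct f →+ CrossedProduct f := mulFinsupp f

instance : Mul (CrossedProduct f) := ⟨fun x y => mulHom f x y⟩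

theorem mul_def (x y : CrossedProduct f) : x * y = mulHom f x y := rfl

theorem single_mul_single (g h : G) (s t : S) :
    single f g s * single f h t = single f (g * h) (s * g • t * (f.val g h : S)) := by
  exact mulFinsupp_single f g h s t

/-- The unit element is `f(1,1)⁻¹ U_1`. -/
instance : One (CrossedProduct f) := ⟨single f 1 ((f.val 1 1)⁻¹ : Sˣ)⟩

theorem one_def : (1 : CrossedProduct f) = single f 1 ((f.val 1 1)⁻¹ : Sˣ) := rfl

instance : Ring (CrossedProduct f) :=
  { (inferInstance : AddCommGroup (CrossedProduct f)),
    (inferInstance : Mul (CrossedProduct f)),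
    (inferInstance : One (CrossedProduct f)) with
    left_distrib := fun x y z => map_add (mulHom f x) y z
    right_distrib := fun x y z => by simp [mul_def]
    zero_mul := fun x => by simp [mul_def]
    mul_zero := fun x => by simp [mul_def]
    mul_assoc := fun x y z => by
      have add_mul' : ∀ a b c : CrossedProduct f, (a + b) * c = a * c + b * c :=
        fun a b c => by simp [mul_def]
      have mul_add' : ∀ a b c : CrossedProduct f, a * (b + c) = a * b + a * c :=
        fun a b c => by simp [mul_def]
      induction x using induction_on with
      | zero => simp [mul_def]
      | add x x' hx hx' => rw [add_mul', add_mul', add_mul', hx, hx']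
      | single g s =>
      induction y using induction_on with
      | zero => simp [mul_def]
      | add y y' hy hy' => rw [mul_add', add_mul', add_mul', mul_add', hy, hy']
      | single h t =>
      induction z using induction_on with
      | zero => simp [mul_def]
      | add z z' hz hz' => rw [mul_add', mul_add', mul_add', hz, hz']
      | single j u =>
        simp only [single_mul_single, mul_assoc, smul_mul', mul_smul]
        congr 1
        have := f.cocycle g h j
        linear_combination (s * g • t * g • h • u) * this
    one_mul := fun x => by
      induction x using induction_on with
      | zero => simp [mul_def]
      | add x y hx hy => rw [mul_def, map_add, ← mul_def, ← mul_def, hx, hy]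
      | single g s =>
        rw [one_def, single_mul_single, f.val_one_left, one_mul, one_smul, mul_right_comm,
          Units.inv_mul, one_mul]
    mul_one := fun x => by
      induction x using induction_on with
      | zero => simp [mul_def]
      | add x y hx hy =>
        rw [mul_def, map_add, AddMonoidHom.add_apply, ← mul_def, ← mul_def, hx, hy]
      | single g s =>
        rw [one_def, single_mul_single, f.val_one_right, mul_one, mul_assoc, ← smul_mul',
          Units.inv_mul, smul_one, mul_one] }

/-- If `G` acts on `S` by `R`-linear automorphisms, then the crossed product is an `R`-algebra,
with `R` acting on the coefficients. -/
instance {R : Type*} [CommRing R] [Algebra R S] [SMulCommClass G R S] :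
    Algebra R (CrossedProduct f) :=
  Algebra.ofModule
    (fun r x y => by
      induction x using induction_on with
      | zero => simp
      | add x x' hx hx' => rw [smul_add, add_mul, add_mul, smul_add, hx, hx']
      | single g s =>
      induction y using induction_on with
      | zero => simp
      | add y y' hy hy' => rw [mul_add, mul_add, smul_add, hy, hy']
      | single h t =>
        simp only [smul_single, single_mul_single, smul_mul_assoc])
    (fun r x y => by
      induction x using induction_on with
      | zero => simp
      | add x x' hx hx' => rw [add_mul, add_mul, smul_add, hx, hx']
      | single g s =>
      induction y using induction_on with
      | zero => simp
      | add y y' hy hy' => rw [smul_add, mul_add, mul_add, smul_add, hy, hy']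
      | single h t =>
        simp only [smul_single, single_mul_single, smul_comm g r t, mul_smul_comm,
          smul_mul_assoc])

variable {R : Type*} [CommRing R] [Algebra R S] [SMulCommClass G R S]

theorem algebraMap_def (r : R) : algebraMap R (CrossedProduct f) r =
    single f 1 (algebraMap R S r * ((f.val 1 1)⁻¹ : Sˣ)) := by
  rw [Algebra.algebraMap_eq_smul_one, one_def, smul_single, Algebra.smul_def]

/-- The inclusion `S → S^f * G`, `s ↦ s · 1`, of the coefficient ring. -/
def coeffHom (R : Type*) [CommRing R] [Algebra R S] [SMulCommClass G R S]
    (f : TwoCocycle G S) : S →ₐ[R] CrossedProduct f where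
  toFun s := single f 1 (s * ((f.val 1 1)⁻¹ : Sˣ))
  map_one' := by rw [one_mul]; rfl
  map_zero' := by rw [zero_mul, single_zero]
  map_add' s t := by rw [add_mul, single_add]
  map_mul' s t := by
    rw [single_mul_single, one_smul, one_mul]
    congr 1
    have := Units.inv_mul (f.val 1 1)
    linear_combination (-(s * t * ((f.val 1 1)⁻¹ : Sˣ))) * this
  commutes' r := (algebraMap_def r).symm

/-- The homomorphism `S^f * G → S'^f * G` given on coefficients by a `G`-equivariant
homomorphism `φ : S → S'` of `R`-algebras. -/
def mapAlgHom {S' : Type*} [CommRing S'] [MulSemiringAction G S'] [Algebra R S']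
    [SMulCommClass G R S'] (f : TwoCocycle G S) (φ : S →ₐ[R] S')
    (hφ : ∀ (g : G) (s : S), (φ : S →+* S') (g • s) = g • (φ : S →+* S') s) :
    CrossedProduct f →ₐ[R] CrossedProduct (f.map (φ : S →+* S') hφ) :=
  have map_single : ∀ (g : G) (s : S),
      Finsupp.mapRange.linearMap (α := G) φ.toLinearMap (single f g s) =
        single (f.map (φ : S →+* S') hφ) g (φ s) :=
    fun g s => Finsupp.mapRange_single (hf := map_zero φ)
  AlgHom.ofLinearMap (A := CrossedProduct f) (B := CrossedProduct (f.map (φ : S →+* S') hφ))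
    (Finsupp.mapRange.linearMap (α := G) φ.toLinearMap)
    (by
      rw [one_def]
      refine (map_single _ _).trans ?_
      rw [one_def]
      congr 1)
    (fun x y => by
      induction x using induction_on with
      | zero => rw [zero_mul]; erw [map_zero]; rw [zero_mul]
      | add x x' hx hx' => rw [add_mul]; erw [map_add, map_add]; rw [hx, hx', ← add_mul]
      | single g s =>
      induction y using induction_on with
      | zero => rw [mul_zero]; erw [map_zero]; rw [mul_zero]
      | add y y' hy hy' => rw [mul_add]; erw [map_add, map_add]; rw [hy, hy', ← mul_add]
      | single h t =>
        rw [single_mul_single]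
        refine (map_single _ _).trans ?_
        erw [map_single, map_single]
        rw [single_mul_single]
        congr 1
        have := hφ g t
        simp only [RingHom.coe_coe] at this
        rw [map_mul, map_mul, this]
        rfl)

end CrossedProduct

/-! ## Completions of algebras -/

/-- The completion `lim A / Iⁿ A` of an algebra `A` (not necessarily commutative) over a
commutative ring `R` with an ideal `I`. Its additive group is that of the `I`-adic completion of
the `R`-module `A`; its product is induced by the product of the rings `A / Iⁿ A`. -/
def AlgCompletion {R : Type*} [CommRing R] (I : Ideal R) (A : Type*) [Ring A] [Algebra R A] :
    Type _ := AdicCompletion I A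

namespace AlgCompletion

variable {R : Type*} [CommRing R] {I : Ideal R} {A B : Type*} [Ring A] [Algebra R A]
  [Ring B] [Algebra R B]

theorem mul_mem_left (J : Ideal R) (a : A) {b : A} (hb : b ∈ (J • ⊤ : Submodule R A)) :
    a * b ∈ (J • ⊤ : Submodule R A) := by
  refine Submodule.smul_induction_on hb (fun r hr x _ => ?_) (fun x y hx hy => ?_)
  · rw [mul_smul_comm]; exact Submodule.smul_mem_smul hr trivial
  · rw [mul_add]; exact add_mem hx hy

theorem mul_mem_right (J : Ideal R) (a : A) {b : A} (hb : b ∈ (J • ⊤ : Submodule R A)) :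
    b * a ∈ (J • ⊤ : Submodule R A) := by
  refine Submodule.smul_induction_on hb (fun r hr x _ => ?_) (fun x y hx hy => ?_)
  · rw [smul_mul_assoc]; exact Submodule.smul_mem_smul hr trivial
  · rw [add_mul]; exact add_mem hx hy

/-- The product of the quotient ring `A / J A`, as a bilinear map. -/
def quotMul (J : Ideal R) : (A ⧸ (J • ⊤ : Submodule R A)) →ₗ[R]
    (A ⧸ (J • ⊤ : Submodule R A)) →ₗ[R] (A ⧸ (J • ⊤ : Submodule R A)) :=
  Submodule.liftQ _
    { toFun := fun a => Submodule.mapQ _ _ (LinearMap.mulLeft R a)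
        (fun _ hb => mul_mem_left J a hb)
      map_add' := fun a b => by
        ext x
        change Submodule.Quotient.mk ((a + b) * x) =
          (Submodule.Quotient.mk (a * x + b * x) : A ⧸ (J • ⊤ : Submodule R A))
        rw [add_mul]
      map_smul' := fun r a => by
        ext x
        change Submodule.Quotient.mk ((r • a) * x) =
          (Submodule.Quotient.mk (r • (a * x)) : A ⧸ (J • ⊤ : Submodule R A))
        rw [smul_mul_assoc] }
    (fun a ha => by
      rw [LinearMap.mem_ker]
      ext x
      exact (Submodule.Quotient.mk_eq_zero _).2 (mul_mem_right J x ha))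

theorem quotMul_mk (J : Ideal R) (a b : A) :
    quotMul J (Submodule.Quotient.mk a) (Submodule.Quotient.mk b) =
      (Submodule.Quotient.mk (a * b) : A ⧸ (J • ⊤ : Submodule R A)) := rfl

instance : AddCommGroup (AlgCompletion I A) := inferInstanceAs (AddCommGroup (AdicCompletion I A))

instance : Module (AdicCompletion I R) (AlgCompletion I A) :=
  inferInstanceAs (Module (AdicCompletion I R) (AdicCompletion I A))

/-- The component in `A / Iⁿ A` of an element of the completion. -/
def comp (n : ℕ) (x : AlgCompletion I A) : A ⧸ (I ^ n • ⊤ : Submodule R A) := x.val n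

@[ext]
theorem ext {x y : AlgCompletion I A} (h : ∀ n, comp n x = comp n y) : x = y :=
  AdicCompletion.ext h

theorem comp_add (n : ℕ) (x y : AlgCompletion I A) : comp n (x + y) = comp n x + comp n y := rfl

theorem comp_zero (n : ℕ) : comp n (0 : AlgCompletion I A) = 0 := rfl

theorem exists_comp_eq (n : ℕ) (x : AlgCompletion I A) :
    ∃ a : A, comp n x = Submodule.Quotient.mk a :=
  (Submodule.Quotient.mk_surjective _ (comp n x)).imp fun _ h => h.symm

theorem transitionMap_mk {m n : ℕ} (hmn : m ≤ n) (a : A) :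
    AdicCompletion.transitionMap I A hmn (Submodule.Quotient.mk a) = Submodule.Quotient.mk a :=
  rfl

theorem transitionMap_quotMul {m n : ℕ} (hmn : m ≤ n)
    (x y : A ⧸ (I ^ n • ⊤ : Submodule R A)) :
    AdicCompletion.transitionMap I A hmn (quotMul (I ^ n) x y) =
      quotMul (I ^ m) (AdicCompletion.transitionMap I A hmn x)
        (AdicCompletion.transitionMap I A hmn y) := by
  obtain ⟨a, rfl⟩ := Submodule.Quotient.mk_surjective _ x
  obtain ⟨b, rfl⟩ := Submodule.Quotient.mk_surjective _ y
  rw [quotMul_mk, transitionMap_mk, transitionMap_mk, transitionMap_mk, quotMul_mk]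

instance : Mul (AlgCompletion I A) where
  mul x y := ⟨fun n => quotMul (I ^ n) (comp n x) (comp n y), fun {m n} hmn => by
    have hx : AdicCompletion.transitionMap I A hmn (comp n x) = comp m x := x.property hmn
    have hy : AdicCompletion.transitionMap I A hmn (comp n y) = comp m y := y.property hmn
    exact (transitionMap_quotMul hmn (comp n x) (comp n y)).trans (by rw [hx, hy])⟩

instance : One (AlgCompletion I A) where
  one := AdicCompletion.of I A 1

theorem comp_mul (n : ℕ) (x y : AlgCompletion I A) :
    comp n (x * y) = quotMul (I ^ n) (comp n x) (comp n y) := rfl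

theorem comp_one (n : ℕ) : comp n (1 : AlgCompletion I A) = Submodule.Quotient.mk 1 := rfl

instance : Ring (AlgCompletion I A) :=
  { (inferInstance : AddCommGroup (AlgCompletion I A)),
    (inferInstance : Mul (AlgCompletion I A)),
    (inferInstance : One (AlgCompletion I A)) with
    left_distrib := fun x y z => by ext n; simp only [comp_mul, comp_add, map_add]
    right_distrib := fun x y z => by
      ext n; simp only [comp_mul, comp_add, map_add, LinearMap.add_apply]
    zero_mul := fun x => by ext n; simp only [comp_mul, comp_zero, map_zero, LinearMap.zero_apply]
    mul_zero := fun x => by ext n; simp only [comp_mul, comp_zero, map_zero]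
    mul_assoc := fun x y z => by
      ext n
      obtain ⟨a, ha⟩ := exists_comp_eq n x
      obtain ⟨b, hb⟩ := exists_comp_eq n y
      obtain ⟨c, hc⟩ := exists_comp_eq n z
      simp only [comp_mul, ha, hb, hc, quotMul_mk, mul_assoc]
    one_mul := fun x => by
      ext n
      obtain ⟨a, ha⟩ := exists_comp_eq n x
      simp only [comp_mul, comp_one, ha, quotMul_mk, one_mul]
    mul_one := fun x => by
      ext n
      obtain ⟨a, ha⟩ := exists_comp_eq n x
      simp only [comp_mul, comp_one, ha, quotMul_mk, mul_one] }

instance {C : Type*} [CommRing C] [Algebra R C] : CommRing (AlgCompletion I C) :=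
  { (inferInstance : Ring (AlgCompletion I C)) with
    mul_comm := fun x y => by
      ext n
      obtain ⟨a, ha⟩ := exists_comp_eq n x
      obtain ⟨b, hb⟩ := exists_comp_eq n y
      simp only [comp_mul, ha, hb, quotMul_mk, mul_comm] }

theorem exists_comp_smul (n : ℕ) (r : AdicCompletion I R) :
    ∃ r₀ : R, ∀ {C : Type _} [Ring C] [Algebra R C] (x : AlgCompletion I C),
      comp n (r • x) = r₀ • comp n x := by
  obtain ⟨r₀, h⟩ := Submodule.Quotient.mk_surjective _ (r.val n)
  refine ⟨r₀, fun {C} _ _ x => ?_⟩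
  change r.val n • x.val n = r₀ • x.val n
  rw [← h]
  obtain ⟨a, ha⟩ := Submodule.Quotient.mk_surjective _ (x.val n)
  rw [← ha]
  rfl

/-- The completion of an `R`-algebra is an algebra over the completion of `R`. -/
instance : Algebra (AdicCompletion I R) (AlgCompletion I A) :=
  Algebra.ofModule
    (fun r x y => by
      ext n
      obtain ⟨r₀, h⟩ := exists_comp_smul n r
      rw [comp_mul, h, h, comp_mul, map_smul, LinearMap.smul_apply])
    (fun r x y => by
      ext n
      obtain ⟨r₀, h⟩ := exists_comp_smul n r
      rw [comp_mul, h, h, comp_mul, map_smul])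

/-- The image in the completion of an element of the algebra. -/
def ofElem (I : Ideal R) (a : A) : AlgCompletion I A := AdicCompletion.of I A a

theorem comp_ofElem (n : ℕ) (a : A) : comp n (ofElem I a) = Submodule.Quotient.mk a := rfl

/-- The canonical homomorphism `A → lim A / Iⁿ A`. -/
def of (I : Ideal R) (A : Type*) [Ring A] [Algebra R A] : A →+* AlgCompletion I A where
  toFun a := ofElem I a
  map_one' := by ext n; rw [comp_ofElem, comp_one]
  map_mul' _ _ := by ext n; rw [comp_ofElem, comp_mul, comp_ofElem, comp_ofElem, quotMul_mk]
  map_zero' := by ext n; rw [comp_ofElem, comp_zero, Submodule.Quotient.mk_zero]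
  map_add' _ _ := by
    ext n; rw [comp_ofElem, comp_add, comp_ofElem, comp_ofElem, Submodule.Quotient.mk_add]

theorem comp_of (n : ℕ) (a : A) : comp n (of I A a) = Submodule.Quotient.mk a := comp_ofElem n a

/-- Functoriality of the completion, on the underlying modules. -/
def mapLinear (I : Ideal R) (φ : A →ₐ[R] B) :
    AlgCompletion I A →ₗ[AdicCompletion I R] AlgCompletion I B :=
  AdicCompletion.map I φ.toLinearMap

theorem comp_mapLinear (φ : A →ₐ[R] B) (n : ℕ) (x : AlgCompletion I A) {a : A}
    (ha : comp n x = Submodule.Quotient.mk a) :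
    comp n (mapLinear I φ x) = Submodule.Quotient.mk (φ a) := by
  have h : comp n (mapLinear I φ x) = Submodule.mapQ _ _ φ.toLinearMap
    (Submodule.smul_top_le_comap_smul_top (I ^ n) φ.toLinearMap) (comp n x) := rfl
  rw [h, ha, Submodule.mapQ_apply]
  rfl

/-- Functoriality of the completion. -/
def map (I : Ideal R) (φ : A →ₐ[R] B) :
    AlgCompletion I A →ₐ[AdicCompletion I R] AlgCompletion I B :=
  AlgHom.ofLinearMap (mapLinear I φ)
    (by
      ext n
      rw [comp_mapLinear φ n 1 (comp_one n), comp_one, map_one])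
    (fun x y => by
      ext n
      obtain ⟨a, ha⟩ := exists_comp_eq n x
      obtain ⟨b, hb⟩ := exists_comp_eq n y
      have hab : comp n (x * y) = Submodule.Quotient.mk (a * b) := by
        rw [comp_mul, ha, hb, quotMul_mk]
      rw [comp_mapLinear φ n _ hab, comp_mul, comp_mapLinear φ n x ha, comp_mapLinear φ n y hb,
        quotMul_mk, map_mul])

theorem comp_map (φ : A →ₐ[R] B) (n : ℕ) (x : AlgCompletion I A) {a : A}
    (ha : comp n x = Submodule.Quotient.mk a) :
    comp n (map I φ x) = Submodule.Quotient.mk (φ a) := comp_mapLinear φ n x ha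

/-- A group acting on `A` by `R`-algebra automorphisms acts on the completion of `A`. -/
instance {G : Type*} [Group G] [MulSemiringAction G A] [SMulCommClass G R A] :
    MulSemiringAction G (AlgCompletion I A) where
  smul g x := map I (MulSemiringAction.toAlgHom R A g) x
  one_smul x := by
    ext n
    obtain ⟨a, ha⟩ := exists_comp_eq n x
    refine (comp_map _ n x ha).trans ?_
    simp [ha]
  mul_smul g h x := by
    ext n
    obtain ⟨a, ha⟩ := exists_comp_eq n x
    refine (comp_map _ n x ha).trans
      (Eq.trans ?_ (comp_map _ n _ (comp_map _ n x ha)).symm)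
    simp [mul_smul]
  smul_zero g := map_zero (map I (MulSemiringAction.toAlgHom R A g))
  smul_add g := map_add (map I (MulSemiringAction.toAlgHom R A g))
  smul_one g := map_one (map I (MulSemiringAction.toAlgHom R A g))
  smul_mul g := map_mul (map I (MulSemiringAction.toAlgHom R A g))

theorem smul_of {G : Type*} [Group G] [MulSemiringAction G A] [SMulCommClass G R A] (g : G)
    (a : A) : g • of I A a = of I A (g • a) := by
  ext n
  exact (comp_map (MulSemiringAction.toAlgHom R A g) n (of I A a) (comp_of n a)).trans
    (comp_of n (g • a)).symm

instance {G : Type*} [Group G] [MulSemiringAction G A] [SMulCommClass G R A] :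
    SMulCommClass G (AdicCompletion I R) (AlgCompletion I A) where
  smul_comm g r x := map_smul (map I (MulSemiringAction.toAlgHom R A g)) r x

end AlgCompletion

/-! ## Primitive idempotents and corners -/

/-- A primitive idempotent of a commutative ring: a nonzero idempotent `e` such that `0` and `e`
are the only idempotents `a` with `a e = a`. -/
structure IsPrimitiveIdempotent {C : Type*} [CommRing C] (e : C) : Prop where
  idem : IsIdempotentElem e
  ne_zero : e ≠ 0
  eq_zero_or_eq : ∀ a : C, IsIdempotentElem a → a * e = a → a = 0 ∨ a = e

namespace IsIdempotentElem.Corner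

/-- The inclusion `e A e → A`. -/
def val {A : Type*} [Semigroup A] {e : A} {he : IsIdempotentElem e} (x : he.Corner) : A := x.1

theorem val_mem {A : Type*} [Semigroup A] {e : A} {he : IsIdempotentElem e} (x : he.Corner) :
    e * x.val = x.val ∧ x.val * e = x.val := (Subsemigroup.mem_corner_iff he).1 x.2

/-- The corner ring `e A e` of an `R`-algebra `A` is an `R`-algebra. -/
instance {R A : Type*} [CommRing R] [Ring A] [Algebra R A] {e : A} (he : IsIdempotentElem e) :
    Algebra R he.Corner where
  smul r x := ⟨r • x.val, by
    have := x.val_mem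
    rw [Subsemigroup.mem_corner_iff he, mul_smul_comm, smul_mul_assoc, this.1, this.2]
    exact ⟨rfl, rfl⟩⟩
  algebraMap :=
    { toFun := fun r => ⟨r • e, by
        rw [Subsemigroup.mem_corner_iff he, mul_smul_comm, smul_mul_assoc, he.eq]
        exact ⟨rfl, rfl⟩⟩
      map_one' := Subtype.ext (one_smul R e)
      map_zero' := Subtype.ext (zero_smul R e)
      map_add' := fun r s => Subtype.ext (add_smul r s e)
      map_mul' := fun r s => Subtype.ext (by
        change (r * s) • e = (r • e) * (s • e)
        rw [smul_mul_smul_comm, he.eq]) }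
  commutes' r x := Subtype.ext (by
    have := x.val_mem
    change (r • e) * x.val = x.val * (r • e)
    rw [mul_smul_comm, smul_mul_assoc, this.1, this.2])
  smul_def' r x := Subtype.ext (by
    have := x.val_mem
    change r • x.val = (r • e) * x.val
    rw [smul_mul_assoc, this.1])

variable {G C : Type*} [Group G] [CommRing C] [MulSemiringAction G C] {e : C}
  (he : IsIdempotentElem e)

/-- The stabilizer of an idempotent `e` acts on the ring `e C e = C e`. -/
instance : MulSemiringAction (MulAction.stabilizer G e) he.Corner where
  smul g x := ⟨(g : G) • x.val, by
    have := x.val_mem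
    have hg : (g : G) • e = e := g.2
    rw [Subsemigroup.mem_corner_iff he]
    have h₁ := smul_mul' (g : G) e x.val
    have h₂ := smul_mul' (g : G) x.val e
    rw [this.1, hg] at h₁
    rw [this.2, hg] at h₂
    exact ⟨h₁.symm, h₂.symm⟩⟩
  one_smul x := Subtype.ext (one_smul G x.val)
  mul_smul g h x := Subtype.ext (mul_smul (g : G) (h : G) x.val)
  smul_zero g := Subtype.ext (smul_zero (g : G))
  smul_add g x y := Subtype.ext (smul_add (g : G) x.val y.val)
  smul_one g := Subtype.ext g.2
  smul_mul g x y := Subtype.ext (smul_mul' (g : G) x.val y.val)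

instance {R : Type*} [CommRing R] [Algebra R C] [SMulCommClass G R C] :
    SMulCommClass (MulAction.stabilizer G e) R he.Corner where
  smul_comm g r x := Subtype.ext (smul_comm (g : G) r x.val)

/-- The projection `C → C e`, `c ↦ c e`. -/
def proj : C →+* he.Corner where
  toFun c := ⟨c * e, by
    rw [Subsemigroup.mem_corner_iff he]
    exact ⟨by rw [mul_comm, mul_assoc, he.eq], by rw [mul_assoc, he.eq]⟩⟩
  map_one' := Subtype.ext (one_mul e)
  map_zero' := Subtype.ext (zero_mul e)
  map_add' c d := Subtype.ext (add_mul c d e)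
  map_mul' c d := Subtype.ext (by
    change c * d * e = c * e * (d * e)
    rw [mul_mul_mul_comm, he.eq])

end IsIdempotentElem.Corner

/-! ## Orders -/

/-- Let `K` be the field of fractions of the domain `R` and `A` a finite dimensional `K`-algebra.
An `R`-order in `A` is an `R`-subalgebra `Γ` of `A` (with the same unit element) that is finitely
generated as an `R`-module and satisfies `K Γ = A`. -/
structure IsOrder (R K : Type*) {A : Type*} [CommRing R] [CommRing K] [Ring A] [Algebra R A]
    [Algebra K A] (Γ : Subalgebra R A) : Prop where
  finite : Module.Finite R Γ
  span_eq_top : Submodule.span K (Γ : Set A) = ⊤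

/-- A maximal `R`-order in `A`: an `R`-order that is not properly contained in another one. -/
def IsMaximalOrderIn (R K : Type*) {A : Type*} [CommRing R] [CommRing K] [Ring A] [Algebra R A]
    [Algebra K A] (Γ : Subalgebra R A) : Prop :=
  Maximal (fun Γ' : Subalgebra R A => IsOrder R K Γ') Γ

/-- An `R`-algebra `Λ` is a maximal `R`-order if it embeds in its ring of quotients
`Frac(R) ⊗_R Λ` and is a maximal `R`-order there. -/
def IsMaximalOrder (R Λ : Type*) [CommRing R] [Ring Λ] [Algebra R Λ] : Prop :=
  Function.Injective
      (Algebra.TensorProduct.includeRight : Λ →ₐ[R] FractionRing R ⊗[R] Λ) ∧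
    IsMaximalOrderIn R (FractionRing R)
      (Algebra.TensorProduct.includeRight : Λ →ₐ[R] FractionRing R ⊗[R] Λ).range

/-- The set of maximal two-sided ideals of a ring. -/
def maximalTwoSidedIdeals (Λ : Type*) [Ring Λ] : Set (TwoSidedIdeal Λ) := {I | IsCoatom I}

/-! ## The objects of the reduction -/

section Reduction

variable {R S G : Type*} [CommRing R] [IsLocalRing R] [CommRing S] [Algebra R S] [Group G]
  [MulSemiringAction G S] [SMulCommClass G R S]

/-- The completion `R̂ = lim R / zⁱ R` of the local ring `R`. -/
abbrev RHat (R : Type*) [CommRing R] [IsLocalRing R] : Type _ :=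
  AdicCompletion (IsLocalRing.maximalIdeal R) R

/-- The completion `Ŝ = lim S / zⁱ S`, where `zR` is the maximal ideal of `R`. -/
abbrev SHat (R S : Type*) [CommRing R] [IsLocalRing R] [CommRing S] [Algebra R S] : Type _ :=
  AlgCompletion (IsLocalRing.maximalIdeal R) S

/-- The completion `T̂ = lim T / zⁱ T` of the crossed product `T = S^f * G`. -/
abbrev THat (R : Type*) [CommRing R] [IsLocalRing R] [Algebra R S] [SMulCommClass G R S]
    (f : TwoCocycle G S) : Type _ :=
  AlgCompletion (IsLocalRing.maximalIdeal R) (CrossedProduct f)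

/-- The canonical homomorphism `Ŝ → T̂` induced by `S → T`. -/
abbrev sHatToTHat (R : Type*) [CommRing R] [IsLocalRing R] [Algebra R S] [SMulCommClass G R S]
    (f : TwoCocycle G S) : SHat R S →ₐ[RHat R] THat R f :=
  AlgCompletion.map (IsLocalRing.maximalIdeal R) (CrossedProduct.coeffHom R f)

/-- The corner `T₁ = e T̂ e` at an idempotent `e` of `Ŝ`. -/
abbrev TCorner (f : TwoCocycle G S) {e : SHat R S} (he : IsIdempotentElem e) : Type _ :=
  (he.map (sHatToTHat R f)).Corner

/-- The `2`-cocycle of the stabilizer `G₁` of the idempotent `e` with values in `(Ŝ e)ˣ`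
induced by `f`. -/
def cornerCocycle (f : TwoCocycle G S) {e : SHat R S} (he : IsIdempotentElem e) :
    TwoCocycle (MulAction.stabilizer G e) he.Corner :=
  (f.restrict (MulAction.stabilizer G e)).map
    ((IsIdempotentElem.Corner.proj he).comp (AlgCompletion.of (IsLocalRing.maximalIdeal R) S))
    (fun g s => Subtype.ext (by
      change AlgCompletion.of (IsLocalRing.maximalIdeal R) S ((g : G) • s) * e =
        (g : G) • (AlgCompletion.of (IsLocalRing.maximalIdeal R) S s * e)
      have hg : (g : G) • e = e := g.2
      rw [smul_mul', hg, AlgCompletion.smul_of]))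

end Reduction

/-- The `2`-cocycle `f` regarded as a cocycle with values in `Lˣ`, where `L` is an `S`-algebra with
a compatible `G`-action (in use: the field of fractions of `S`). -/
abbrev fractionCocycle (R : Type*) {S G : Type*} (L : Type*) [CommRing R] [CommRing S]
    [Algebra R S] [Group G] [MulSemiringAction G S] [CommRing L] [Algebra S L] [Algebra R L]
    [IsScalarTower R S L] [MulSemiringAction G L] [SMulDistribClass G S L]
    (f : TwoCocycle G S) : TwoCocycle G L :=
  f.map (IsScalarTower.toAlgHom R S L : S →+* L) (fun g s => algebraMap.smul' g s L)

/-- The crossed product `T = S^f * G` as an `R`-subalgebra of `L^f * G`. -/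
def crossedProductOrder (R : Type*) {S G : Type*} (L : Type*) [CommRing R] [CommRing S]
    [Algebra R S] [Group G] [MulSemiringAction G S] [SMulCommClass G R S] [CommRing L]
    [Algebra S L] [Algebra R L] [IsScalarTower R S L] [MulSemiringAction G L]
    [SMulDistribClass G S L] [SMulCommClass G R L] (f : TwoCocycle G S) :
    Subalgebra R (CrossedProduct (fractionCocycle R L f)) :=
  (CrossedProduct.mapAlgHom f (IsScalarTower.toAlgHom R S L)
    (fun g s => algebraMap.smul' g s L)).range

end

/-! Maximality is first rewritten without reference to the ambient algebra. Let `Λ` be a full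
lattice over a discrete valuation ring with uniformizer `ϖ`. An overorder `Γ` is finitely generated,
so `ϖⁿ Γ ⊆ Λ` for some `n`. Then `J = ϖⁿ Γ` is a two-sided ideal of `Λ` that contains `ϖⁿ` and
satisfies `J J ⊆ ϖⁿ J`. Conversely, every such ideal gives the overorder `ϖ⁻ⁿ J`. Hence `Λ` is
maximal exactly when `NoProperOverring` holds (`isMaximalOrderIn_range_iff`), and this condition can
be moved between rings by correspondences of ideals.

From `T` to `T̂`: the completion of `R` is again a discrete valuation ring with uniformizer `z`, and
`T / zⁿ T` is isomorphic to `T̂ / zⁿ T̂`. Ideals containing `zⁿ` therefore correspond, compatibly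
with the product condition (`noProperOverring_iff_of_dense`).

From `T̂` to the corner: a `G`-invariant idempotent of `Ŝ` is `0` or `1`. To see this, approximate
it modulo `z` by an element of `S`, whose norm lies in the local ring `R`
(`eq_zero_or_eq_one_of_isIdempotentElem`). The distinct conjugates of the primitive idempotent `e`
are orthogonal, so they sum to `1`. Each of them is `U_g e U_g⁻¹` in `T̂`, so `T̂ e T̂ = T̂`. For
such a full idempotent, `J ↦ J ∩ e T̂ e` is a bijection on two-sided ideals that respects the
product condition (`IsIdempotentElem.Corner.noProperOverring_iff`).

The same correspondences match the maximal two-sided ideals. On the completion side this needs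
Nakayama, which puts `z` in every maximal ideal; finiteness holds because `T / zT` is Artinian. The
corner is a crossed product of the stabilizer because `e (s U_g) e = e s g(e) U_g`, where `e g(e) =
0` unless `g` fixes `e` (`cornerAlgHom_bijective`). -/

/-! ## An ideal-theoretic criterion for maximality of orders -/

/-- For a central element `z` of the ring `Λ`: every two-sided ideal `J` of `Λ` with `zⁿ ∈ J` and
`J J ⊆ zⁿ J` is contained in `zⁿ Λ`. Equivalently, `Λ` has no proper overring of the
form `z⁻ⁿ J`. -/
def NoProperOverring {Λ : Type*} [Ring Λ] (z : Λ) : Prop :=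
  ∀ (n : ℕ) (J : TwoSidedIdeal Λ), z ^ n ∈ J →
    (∀ a ∈ J, ∀ b ∈ J, ∃ c ∈ J, a * b = z ^ n * c) → ∀ a ∈ J, ∃ c, a = z ^ n * c

theorem smul_left_cancel_of_isFractionRing {R A : Type*} (K : Type*) [CommRing R] [IsDomain R]
    [CommRing K] [Algebra R K] [IsFractionRing R K] [Ring A] [Algebra R A] [Algebra K A]
    [IsScalarTower R K A] {r : R} (hr : r ≠ 0) {a b : A} (h : r • a = r • b) : a = b := by
  have hu : IsUnit (algebraMap R K r) :=
    IsLocalization.map_units K (⟨r, mem_nonZeroDivisors_of_ne_zero hr⟩ : nonZeroDivisors R)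
  rw [← algebraMap_smul K r a, ← algebraMap_smul K r b] at h
  exact hu.smul_left_cancel.1 h

section OrderCriterion

variable {R K A Λ : Type*} [CommRing R] [IsDomain R] [IsDiscreteValuationRing R] [CommRing K]
  [Algebra R K] [IsFractionRing R K] [Ring Λ] [Algebra R Λ] [Ring A] [Algebra R A] [Algebra K A]
  [IsScalarTower R K A]

/-- A module-finite algebra `Λ` over a discrete valuation ring, embedded as a full lattice in an
algebra over the field of fractions, is a maximal order if and only if it has no proper overring
of the form `ϖ⁻ⁿ J`. -/
theorem isMaximalOrderIn_range_iff [Module.Finite R Λ] {ϖ : R} (hϖ : Irreducible ϖ)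
    (j : Λ →ₐ[R] A) (hj : Function.Injective j)
    (hfull : ∀ a : A, ∃ r : R, r ≠ 0 ∧ ∃ x, r • a = j x) :
    IsMaximalOrderIn R K j.range ↔ NoProperOverring (algebraMap R Λ ϖ) := by
  have cancel {r : R} (hr : r ≠ 0) {a b : A} (h : r • a = r • b) : a = b :=
    smul_left_cancel_of_isFractionRing K hr h
  have hz (n : ℕ) : ϖ ^ n ≠ 0 := pow_ne_zero n hϖ.ne_zero
  have hzj (n : ℕ) (x : Λ) : j (algebraMap R Λ ϖ ^ n * x) = ϖ ^ n • j x := by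
    rw [← map_pow, ← Algebra.smul_def, map_smul]
  have hspan : Submodule.span K (j.range : Set A) = ⊤ := by
    refine eq_top_iff.2 fun a _ => ?_
    obtain ⟨r, hr, x, hx⟩ := hfull a
    obtain ⟨u, hu⟩ := (IsLocalization.map_units K
      (⟨r, mem_nonZeroDivisors_of_ne_zero hr⟩ : nonZeroDivisors R))
    have : a = (↑u⁻¹ : K) • j x := by
      rw [← hx, ← algebraMap_smul K r a, smul_smul]
      simp only at hu
      rw [← hu, Units.inv_mul, one_smul]
    rw [this]
    exact Submodule.smul_mem _ _ (Submodule.subset_span ⟨x, rfl⟩)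
  constructor
  · intro hmax n J hn hJ a ha
    -- This is `ϖ⁻ⁿ J`. The condition `J J ⊆ ϖⁿ J` is exactly its closure under multiplication, and
    -- `ϖⁿ ∈ J` puts `Λ` inside it.
    let Γ : Subalgebra R A :=
      { carrier := {a | ∃ c ∈ J, ϖ ^ n • a = j c}
        mul_mem' := by
          rintro a b ⟨c, hc, hac⟩ ⟨d, hd, hbd⟩
          obtain ⟨c', hc', h⟩ := hJ c hc d hd
          refine ⟨c', hc', cancel (hz n) ?_⟩
          rw [← hzj, ← h, map_mul, ← hac, ← hbd, smul_mul_assoc, mul_smul_comm]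
        add_mem' := by
          rintro a b ⟨c, hc, hac⟩ ⟨d, hd, hbd⟩
          exact ⟨c + d, J.add_mem hc hd, by rw [smul_add, map_add, hac, hbd]⟩
        algebraMap_mem' := fun r => by
          refine ⟨algebraMap R Λ ϖ ^ n * algebraMap R Λ r, J.mul_mem_right _ _ hn, ?_⟩
          rw [hzj, AlgHom.commutes] }
    have hle : j.range ≤ Γ := by
      rintro _ ⟨x, rfl⟩
      exact ⟨algebraMap R Λ ϖ ^ n * x, J.mul_mem_right _ _ hn, (hzj n x).symm⟩
    have hΓ : IsOrder R K Γ := by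
      refine ⟨?_, ?_⟩
      -- Multiplication by `ϖⁿ` embeds `Γ` into the image of `Λ`, which is a Noetherian `R`-module.
      · let g : Γ →ₗ[R] LinearMap.range j.toLinearMap :=
          LinearMap.codRestrict _ ((LinearMap.lsmul R A (ϖ ^ n)).comp Γ.val.toLinearMap)
            (fun x => by
              obtain ⟨c, -, hc⟩ := x.2
              exact ⟨c, hc.symm⟩)
        refine Module.Finite.of_injective g fun x y h => Subtype.ext (cancel (hz n) ?_)
        exact congrArg Subtype.val h
      · exact eq_top_iff.2 (hspan ▸ Submodule.span_mono hle)
    have hmem : ∃ b ∈ Γ, ϖ ^ n • b = j a := by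
      obtain ⟨u, hu⟩ := (IsLocalization.map_units K
        (⟨ϖ ^ n, mem_nonZeroDivisors_of_ne_zero (hz n)⟩ : nonZeroDivisors R))
      have : ϖ ^ n • ((↑u⁻¹ : K) • j a) = j a := by
        rw [← algebraMap_smul K (ϖ ^ n), smul_smul]
        simp only at hu
        rw [← hu, Units.mul_inv, one_smul]
      exact ⟨_, ⟨a, ha, this⟩, this⟩
    obtain ⟨b, hb, hba⟩ := hmem
    obtain ⟨c, hc⟩ := hmax.2 hΓ hle hb
    refine ⟨c, hj ?_⟩
    rw [hzj, ← hba, ← hc]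
    rfl
  · intro hC
    refine ⟨⟨?_, hspan⟩, fun Γ hΓ hle => ?_⟩
    · exact Module.Finite.range j.toLinearMap
    have hfin := hΓ.finite
    -- A common denominator for finitely many generators of `Γ`; up to a unit of `R`, each
    -- denominator is a power of `ϖ`.
    have hbound : ∃ n : ℕ, ∀ a ∈ Γ, ∃ x, ϖ ^ n • a = j x := by
      obtain ⟨s, hs⟩ := (Module.Finite.iff_fg (N := Subalgebra.toSubmodule Γ)).1 hfin
      have hone (a : A) : ∃ n : ℕ, ∃ x, ϖ ^ n • a = j x := by
        obtain ⟨r, hr, x, hx⟩ := hfull a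
        obtain ⟨n, u, hu⟩ := IsDiscreteValuationRing.eq_unit_mul_pow_irreducible hr hϖ
        refine ⟨n, (↑u⁻¹ : R) • x, ?_⟩
        rw [map_smul, ← hx, hu, smul_smul, ← mul_assoc, Units.inv_mul, one_mul]
      choose N x hx using hone
      refine ⟨s.sup N, fun a ha => ?_⟩
      have ha' : a ∈ Submodule.span R (s : Set A) := by rw [hs]; exact ha
      induction ha' using Submodule.span_induction with
      | mem b hb =>
        obtain ⟨k, hk⟩ := Nat.exists_eq_add_of_le (Finset.le_sup (f := N) hb)
        exact ⟨ϖ ^ k • x b, by rw [hk, add_comm, pow_add, mul_smul, hx, map_smul]⟩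
      | zero => exact ⟨0, by simp⟩
      | add b c hb hc ihb ihc =>
        obtain ⟨y, hy⟩ := ihb (by have := hs.le hb; exact this)
        obtain ⟨y', hy'⟩ := ihc (by have := hs.le hc; exact this)
        exact ⟨y + y', by rw [smul_add, hy, hy', map_add]⟩
      | smul r b hb ih =>
        obtain ⟨y, hy⟩ := ih (by have := hs.le hb; exact this)
        exact ⟨r • y, by rw [smul_comm, hy, map_smul]⟩
    obtain ⟨n, hn⟩ := hbound
    -- The ideal `ϖⁿ Γ`, which lies inside `Λ` by the choice of `n`.
    let J : TwoSidedIdeal Λ := TwoSidedIdeal.mk' {x | ∃ a ∈ Γ, ϖ ^ n • a = j x}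
      ⟨0, Γ.zero_mem, by simp⟩
      (by
        rintro x y ⟨a, ha, hax⟩ ⟨b, hb, hby⟩
        exact ⟨a + b, Γ.add_mem ha hb, by rw [smul_add, hax, hby, map_add]⟩)
      (by
        rintro x ⟨a, ha, hax⟩
        exact ⟨-a, neg_mem ha, by rw [smul_neg, hax, map_neg]⟩)
      (by
        rintro x y ⟨a, ha, hax⟩
        exact ⟨j x * a, Γ.mul_mem (hle ⟨x, rfl⟩) ha, by rw [map_mul, ← hax, mul_smul_comm]⟩)
      (by
        rintro x y ⟨a, ha, hax⟩
        exact ⟨a * j y, Γ.mul_mem ha (hle ⟨y, rfl⟩), by rw [map_mul, ← hax, smul_mul_assoc]⟩)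
    have hJ (x : Λ) : x ∈ J ↔ ∃ a ∈ Γ, ϖ ^ n • a = j x := TwoSidedIdeal.mem_mk' ..
    intro a ha
    obtain ⟨x, hx⟩ := hn a ha
    obtain ⟨c, hc⟩ := hC n J
      ((hJ _).2 ⟨1, Γ.one_mem, by rw [← mul_one (_ ^ n : Λ), hzj, map_one]⟩)
      (fun x hx y hy => by
        obtain ⟨a, ha, hax⟩ := (hJ x).1 hx
        obtain ⟨b, hb, hby⟩ := (hJ y).1 hy
        obtain ⟨c, hc⟩ := hn (a * b) (Γ.mul_mem ha hb)
        refine ⟨c, (hJ c).2 ⟨_, Γ.mul_mem ha hb, hc⟩, hj ?_⟩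
        rw [hzj, ← hc, map_mul, ← hax, ← hby, smul_mul_assoc, mul_smul_comm])
      x ((hJ x).2 ⟨a, ha, hx⟩)
    refine ⟨c, cancel (hz n) ?_⟩
    rw [hx, hc, hzj]
    rfl

/-- The criterion for `Λ` as an order in `Frac(R) ⊗ Λ`. -/
theorem isMaximalOrder_iff [Module.Finite R Λ] [Module.IsTorsionFree R Λ] {ϖ : R}
    (hϖ : Irreducible ϖ) :
    IsMaximalOrder R Λ ↔ NoProperOverring (algebraMap R Λ ϖ) := by
  have hinj : Function.Injective
      (Algebra.TensorProduct.includeRight : Λ →ₐ[R] TensorProduct R (FractionRing R) Λ) :=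
    Algebra.TensorProduct.includeRight_injective (IsFractionRing.injective R (FractionRing R))
  rw [IsMaximalOrder, and_iff_right hinj]
  refine isMaximalOrderIn_range_iff hϖ _ hinj fun a => ?_
  induction a using TensorProduct.induction_on with
  | zero => exact ⟨1, one_ne_zero, 0, by simp⟩
  | tmul q x =>
    obtain ⟨⟨p, r⟩, hr⟩ := IsLocalization.surj (nonZeroDivisors R) q
    refine ⟨r, nonZeroDivisors.coe_ne_zero r, p • x, ?_⟩
    rw [TensorProduct.smul_tmul', Algebra.smul_def, mul_comm, hr, Algebra.algebraMap_eq_smul_one,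
      TensorProduct.smul_tmul]
    rfl
  | add a b ha hb =>
    obtain ⟨r, hr, x, hx⟩ := ha
    obtain ⟨s, hs, y, hy⟩ := hb
    refine ⟨r * s, mul_ne_zero hr hs, s • x + r • y, ?_⟩
    rw [smul_add, map_add, map_smul, map_smul, ← hx, ← hy, smul_smul, smul_smul, mul_comm s r]

end OrderCriterion

/-! ## Ideals under dense homomorphisms -/

section DenseHom

variable {A B : Type*} [Ring A] [Ring B] {φ : A →+* B} {z : A}

/-- The two-sided ideal `φ(J) + w B` of `B`, for a ring homomorphism `φ : A → B` with
`φ(A) + w B = B`, and a central element `w` of `B`. -/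
def TwoSidedIdeal.mapAdd (φ : A →+* B) (w : B) (hw : ∀ b, Commute w b)
    (hd : ∀ b, ∃ a c, b = φ a + w * c) (J : TwoSidedIdeal A) : TwoSidedIdeal B :=
  TwoSidedIdeal.mk' {b | ∃ a ∈ J, ∃ c, b = φ a + w * c}
    ⟨0, J.zero_mem, 0, by simp⟩
    (by
      rintro _ _ ⟨a, ha, c, rfl⟩ ⟨a', ha', c', rfl⟩
      exact ⟨a + a', J.add_mem ha ha', c + c', by rw [map_add, mul_add]; abel⟩)
    (by
      rintro _ ⟨a, ha, c, rfl⟩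
      exact ⟨-a, J.neg_mem ha, -c, by rw [map_neg, mul_neg]; abel⟩)
    (by
      rintro y _ ⟨a, ha, c, rfl⟩
      obtain ⟨a', c', rfl⟩ := hd y
      refine ⟨a' * a, J.mul_mem_left _ _ ha, c' * φ a + φ a' * c + w * c' * c, ?_⟩
      have h := (hw (φ a')).eq
      simp only [map_mul, mul_add, add_mul, mul_assoc]
      rw [← mul_assoc w (φ a') c, h, ← mul_assoc c' w c, ← (hw c').eq]
      simp only [mul_assoc]
      abel)
    (by
      rintro _ y ⟨a, ha, c, rfl⟩
      obtain ⟨a', c', rfl⟩ := hd y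
      refine ⟨a * a', J.mul_mem_right _ _ ha, φ a * c' + c * φ a' + c * (w * c'), ?_⟩
      have h := (hw (φ a)).eq
      simp only [map_mul, mul_add, add_mul, mul_assoc]
      rw [← mul_assoc w (φ a) c', h]
      simp only [mul_assoc]
      abel)

theorem TwoSidedIdeal.mem_mapAdd {w : B} {hw : ∀ b, Commute w b}
    {hd : ∀ b, ∃ a c, b = φ a + w * c} {J : TwoSidedIdeal A} {b : B} :
    b ∈ TwoSidedIdeal.mapAdd φ w hw hd J ↔ ∃ a ∈ J, ∃ c, b = φ a + w * c :=
  TwoSidedIdeal.mem_mk' ..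

/-- The hypotheses `hd` and `hk` say that `φ` induces a surjective and injective map `A / zⁿ A → B /
φ(z)ⁿ B`. Ideals containing the `n`-th powers then correspond under preimage and `J ↦ φ(J) + φ(z)ⁿ
B`. Regularity of `φ(z)` allows a factor `φ(z)ⁿ` to be cancelled when the product condition is
pulled back. -/
theorem noProperOverring_iff_of_dense (hz : ∀ b, Commute (φ z) b)
    (hreg : ∀ (n : ℕ) (b c : B), φ z ^ n * b = φ z ^ n * c → b = c)
    (hd : ∀ (n : ℕ) (b : B), ∃ a c, b = φ a + φ z ^ n * c)
    (hk : ∀ (n : ℕ) (a : A) (c : B), φ a = φ z ^ n * c → ∃ a', a = z ^ n * a') :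
    NoProperOverring z ↔ NoProperOverring (φ z) := by
  constructor
  · intro hA n J hn hJ b hb
    obtain ⟨a, c, rfl⟩ := hd n b
    have ha : φ a ∈ J := by
      simpa using J.sub_mem hb (J.mul_mem_right _ c hn)
    obtain ⟨a', rfl⟩ := hA n (TwoSidedIdeal.comap φ J)
      (by rw [TwoSidedIdeal.mem_comap, map_pow]; exact hn)
      (fun x hx y hy => by
        rw [TwoSidedIdeal.mem_comap] at hx hy
        obtain ⟨c, hc, h⟩ := hJ _ hx _ hy
        -- The cofactor `c` is only known to lie in `B`: `hk` supplies a cofactor `t` in `A`, and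
        -- `hreg` identifies `φ t` with `c`.
        rw [← map_mul] at h
        obtain ⟨t, ht⟩ := hk n _ _ h
        refine ⟨t, ?_, ht⟩
        rw [ht, map_mul, map_pow] at h
        rw [TwoSidedIdeal.mem_comap, hreg n _ _ h]
        exact hc)
      a ((TwoSidedIdeal.mem_comap φ).2 ha)
    exact ⟨φ a' + c, by rw [map_mul, map_pow, mul_add]⟩
  · intro hB n J hn hJ a ha
    have hw (b : B) : Commute (φ z ^ n) b := (hz b).pow_left n
    let I := TwoSidedIdeal.mapAdd φ (φ z ^ n) hw (hd n) J
    have hI {b : B} : b ∈ I ↔ ∃ a ∈ J, ∃ c, b = φ a + φ z ^ n * c := TwoSidedIdeal.mem_mapAdd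
    have hφI {a : A} (ha : a ∈ J) : φ a ∈ I := hI.2 ⟨a, ha, 0, by simp⟩
    have hnI : φ z ^ n ∈ I := by rw [← map_pow]; exact hφI hn
    obtain ⟨c, hc⟩ := hB n I hnI
      (fun x hx y hy => by
        obtain ⟨a, ha, c, rfl⟩ := hI.1 hx
        obtain ⟨a', ha', c', rfl⟩ := hI.1 hy
        obtain ⟨t, ht, h⟩ := hJ a ha a' ha'
        refine ⟨φ t + c * φ a' + φ a * c' + φ z ^ n * (c * c'),
          I.add_mem (I.add_mem (I.add_mem (hφI ht) (I.mul_mem_left _ _ (hφI ha')))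
            (I.mul_mem_right _ _ (hφI ha))) (I.mul_mem_right _ _ hnI), ?_⟩
        have h' : φ a * φ a' = φ z ^ n * φ t := by rw [← map_mul, h, map_mul, map_pow]
        simp only [mul_add, add_mul, h', mul_assoc]
        rw [← mul_assoc (φ a) (φ z ^ n) c', ← (hw (φ a)).eq, ← mul_assoc c (φ z ^ n) c',
          ← (hw c).eq]
        simp only [mul_assoc]
        abel)
      (φ a) (hφI ha)
    exact hk n a c hc

/-- `F` and `H` are mutually inverse and monotone between the upper sets cut out by `p` and `q`.
These contain the top and all coatoms, and being a coatom depends only on the elements above, so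
coatoms are matched. The predicates allow for correspondences that hold only for ideals containing a
fixed element. -/
theorem encard_setOf_isCoatom_eq {α β : Type*} [PartialOrder α] [OrderTop α] [PartialOrder β]
    [OrderTop β] {p : α → Prop} {q : β → Prop} {F : α → β} {H : β → α} (hF : Monotone F)
    (hH : Monotone H) (hp : ∀ a, IsCoatom a → p a) (hq : ∀ b, IsCoatom b → q b)
    (hpt : p ⊤) (hqt : q ⊤) (hp' : ∀ a b, p a → a ≤ b → p b) (hq' : ∀ a b, q a → a ≤ b → q b)
    (hFq : ∀ a, p a → q (F a)) (hHp : ∀ b, q b → p (H b))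
    (hHF : ∀ a, p a → H (F a) = a) (hFH : ∀ b, q b → F (H b) = b) :
    {a : α | IsCoatom a}.encard = {b : β | IsCoatom b}.encard := by
  have hFt : F ⊤ = ⊤ := top_le_iff.1 ((hFH ⊤ hqt).ge.trans (hF le_top))
  have hHt : H ⊤ = ⊤ := top_le_iff.1 ((hHF ⊤ hpt).ge.trans (hH le_top))
  have h1 (a : α) (ha : IsCoatom a) : IsCoatom (F a) := by
    have hpa := hp a ha
    refine ⟨fun h => ha.1 (by rw [← hHF a hpa, h, hHt]), fun b hb => ?_⟩
    have hqb := hq' _ _ (hFq a hpa) hb.le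
    rw [← hFH b hqb, ha.2 (H b), hFt]
    refine lt_of_le_of_ne ((hHF a hpa).ge.trans (hH hb.le)) fun h => hb.ne ?_
    rw [h, hFH b hqb]
  have h2 (b : β) (hb : IsCoatom b) : IsCoatom (H b) := by
    have hqb := hq b hb
    refine ⟨fun h => hb.1 (by rw [← hFH b hqb, h, hFt]), fun a ha => ?_⟩
    have hpa := hp' _ _ (hHp b hqb) ha.le
    rw [← hHF a hpa, hb.2 (F a), hHt]
    refine lt_of_le_of_ne ((hFH b hqb).ge.trans (hF ha.le)) fun h => ha.ne ?_
    rw [h, hHF a hpa]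
  have himage : F '' {a : α | IsCoatom a} = {b : β | IsCoatom b} := by
    ext b
    constructor
    · rintro ⟨a, ha, rfl⟩
      exact h1 a ha
    · exact fun hb => ⟨H b, h2 b hb, hFH b (hq b hb)⟩
  rw [← himage, Set.InjOn.encard_image]
  intro a ha b hb h
  rw [← hHF a (hp a ha), h, hHF b (hp b hb)]

/-- Maximal ideals containing `z` are those of `A / zA`, so only the first power of `z` is needed.
-/
theorem encard_maximalTwoSidedIdeals_eq_of_dense (hz : ∀ b, Commute (φ z) b)
    (hd : ∀ b : B, ∃ a c, b = φ a + φ z * c)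
    (hk : ∀ (a : A) (c : B), φ a = φ z * c → ∃ a', a = z * a')
    (hA : ∀ M ∈ maximalTwoSidedIdeals A, z ∈ M)
    (hB : ∀ M ∈ maximalTwoSidedIdeals B, φ z ∈ M) :
    (maximalTwoSidedIdeals A).encard = (maximalTwoSidedIdeals B).encard := by
  refine encard_setOf_isCoatom_eq (p := fun I => z ∈ I) (q := fun I => φ z ∈ I)
    (F := TwoSidedIdeal.mapAdd φ (φ z) hz hd) (H := TwoSidedIdeal.comap φ)
    ?_ (TwoSidedIdeal.comap φ).monotone hA hB trivial trivial (fun _ _ h h' => h' h)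
    (fun _ _ h h' => h' h) ?_ (fun _ h => (TwoSidedIdeal.mem_comap φ).2 h) ?_ ?_
  · intro I J h b hb
    obtain ⟨a, ha, c, hc⟩ := TwoSidedIdeal.mem_mapAdd.1 hb
    exact TwoSidedIdeal.mem_mapAdd.2 ⟨a, h ha, c, hc⟩
  · exact fun I _ => TwoSidedIdeal.mem_mapAdd.2 ⟨0, I.zero_mem, 1, by simp⟩
  · refine fun I hI => TwoSidedIdeal.ext fun a => ?_
    rw [TwoSidedIdeal.mem_comap, TwoSidedIdeal.mem_mapAdd]
    refine ⟨?_, fun ha => ⟨a, ha, 0, by simp⟩⟩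
    rintro ⟨a', ha', c, hc⟩
    obtain ⟨t, ht⟩ := hk (a - a') c (by rw [map_sub, hc]; abel)
    rw [← sub_add_cancel a a', ht]
    exact I.add_mem (I.mul_mem_right _ _ hI) ha'
  · refine fun I hI => TwoSidedIdeal.ext fun b => ?_
    rw [TwoSidedIdeal.mem_mapAdd]
    constructor
    · rintro ⟨a, ha, c, rfl⟩
      exact I.add_mem ((TwoSidedIdeal.mem_comap φ).1 ha) (I.mul_mem_right _ _ hI)
    · intro hb
      obtain ⟨a, c, rfl⟩ := hd b
      refine ⟨a, (TwoSidedIdeal.mem_comap φ).2 ?_, c, rfl⟩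
      have := I.sub_mem hb (I.mul_mem_right _ c hI)
      rwa [add_sub_cancel_right] at this

end DenseHom

/-! ## Corners at full idempotents -/

namespace IsIdempotentElem.Corner

variable {B : Type*} [Ring B] {e : B} (he : IsIdempotentElem e)

theorem val_injective : Function.Injective (val : he.Corner → B) := Subtype.val_injective

/-- The element `e b e` of the corner ring. -/
def compress (b : B) : he.Corner := ⟨e * b * e, b, rfl⟩

/-- The inclusion `e B e → B` as an additive map. -/
def valHom : he.Corner →+ B where
  toFun := val
  map_zero' := rfl
  map_add' _ _ := rfl

theorem val_compress (b : B) : (compress he b).val = e * b * e := rfl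

theorem val_mul (x y : he.Corner) : (x * y).val = x.val * y.val := rfl

theorem val_add (x y : he.Corner) : (x + y).val = x.val + y.val := rfl

theorem val_neg (x : he.Corner) : (-x).val = -x.val := rfl

theorem val_zero : (0 : he.Corner).val = 0 := rfl

theorem val_one : (1 : he.Corner).val = e := rfl

theorem compress_val (x : he.Corner) : compress he x.val = x :=
  val_injective he (by rw [val_compress, x.val_mem.1, x.val_mem.2])

theorem compress_zero : compress he 0 = 0 := val_injective he (by simp [val_compress, val_zero])

theorem compress_add (a b : B) : compress he (a + b) = compress he a + compress he b :=
  val_injective he (by simp only [val_compress, val_add, mul_add, add_mul])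

theorem compress_neg (a : B) : compress he (-a) = -compress he a :=
  val_injective he (by simp [val_compress, val_neg])

/-- The trace `J ∩ e B e` of a two-sided ideal on the corner ring. -/
def trace (J : TwoSidedIdeal B) : TwoSidedIdeal he.Corner :=
  TwoSidedIdeal.mk' {x | x.val ∈ J} J.zero_mem (fun h h' => J.add_mem h h')
    (fun h => J.neg_mem h) (fun h => J.mul_mem_left _ _ h) (fun h => J.mul_mem_right _ _ h)

theorem mem_trace {J : TwoSidedIdeal B} {x : he.Corner} : x ∈ trace he J ↔ x.val ∈ J :=
  TwoSidedIdeal.mem_mk' ..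

/-- The largest two-sided ideal `{b | e B b B e ⊆ J}` of `B` whose trace on the corner ring is
contained in `J`. -/
def lift (J : TwoSidedIdeal he.Corner) : TwoSidedIdeal B :=
  TwoSidedIdeal.mk' {b | ∀ x y, compress he (x * b * y) ∈ J}
    (fun x y => by rw [mul_zero, zero_mul, compress_zero]; exact J.zero_mem)
    (fun h h' x y => by rw [mul_add, add_mul, compress_add]; exact J.add_mem (h x y) (h' x y))
    (fun h x y => by rw [mul_neg, neg_mul, compress_neg]; exact J.neg_mem (h x y))
    (fun {b c} h x y => by rw [← mul_assoc x b c]; exact h _ _)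
    (fun {b c} h x y => by rw [← mul_assoc x b c, mul_assoc _ c y]; exact h _ _)

theorem mem_lift {J : TwoSidedIdeal he.Corner} {b : B} :
    b ∈ lift he J ↔ ∀ x y, compress he (x * b * y) ∈ J :=
  TwoSidedIdeal.mem_mk' ..

/-- As `x = e x e`, compressing `a x b` gives `(e a e) x (e b e)`, which stays in the ideal `J` of
the corner. -/
theorem val_mem_lift_iff {J : TwoSidedIdeal he.Corner} {x : he.Corner} :
    x.val ∈ lift he J ↔ x ∈ J := by
  rw [mem_lift]
  constructor
  · intro h
    simpa [compress_val] using h 1 1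
  · intro h a b
    have : compress he (a * x.val * b) = compress he a * x * compress he b :=
      val_injective he (by
        simp only [val_compress, val_mul]
        conv_lhs => rw [← x.val_mem.1, ← x.val_mem.2]
        simp only [mul_assoc])
    rw [this]
    exact J.mul_mem_right _ _ (J.mul_mem_left _ _ h)

theorem trace_lift (J : TwoSidedIdeal he.Corner) : trace he (lift he J) = J :=
  TwoSidedIdeal.ext fun _ => (mem_trace he).trans (val_mem_lift_iff he)

variable {ι : Type*} {s : Finset ι} {x y : ι → B}

/-- Insert `1 = ∑ x i e y i` on both sides of `b`. The elements `e (y i) b (x j) e` act as matrix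
coordinates of `b` with entries in the corner; `hfull` expresses `B e B = B`. -/
theorem eq_sum_compress (hfull : ∑ i ∈ s, x i * e * y i = 1) (b : B) :
    b = ∑ i ∈ s, ∑ j ∈ s, x i * (compress he (y i * b * x j)).val * y j := by
  conv_lhs => rw [← one_mul b, ← mul_one (1 * b), ← hfull, Finset.sum_mul, Finset.sum_mul]
  refine Finset.sum_congr rfl fun i _ => ?_
  rw [Finset.mul_sum]
  refine Finset.sum_congr rfl fun j _ => ?_
  rw [val_compress]
  simp only [mul_assoc]

/-- Inserting `1 = ∑ x m e y m` between `a` and `b` gives the matrix multiplication rule for these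
coordinates. -/
theorem compress_mul_mul_eq_sum (hfull : ∑ i ∈ s, x i * e * y i = 1) (p a b q : B) :
    compress he (p * (a * b) * q) =
      ∑ m ∈ s, compress he (p * a * x m) * compress he (y m * b * q) := by
  refine val_injective he ?_
  have hsum : (∑ m ∈ s, compress he (p * a * x m) * compress he (y m * b * q)).val =
      ∑ m ∈ s, (compress he (p * a * x m) * compress he (y m * b * q)).val :=
    map_sum (valHom he) _ s
  rw [hsum, val_compress]
  conv_lhs => rw [← mul_one a, ← hfull]
  simp only [Finset.mul_sum, Finset.sum_mul]
  refine Finset.sum_congr rfl fun m _ => ?_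
  rw [val_mul, val_compress, val_compress]
  have h (u : B) : e * (e * u) = e * u := by rw [← mul_assoc, he.eq]
  simp only [mul_assoc, h]

/-- An element whose corner coordinates all lie in `J` is rebuilt from them inside `J`; this is
where fullness of `e` enters. -/
theorem lift_trace (hfull : ∑ i ∈ s, x i * e * y i = 1) (J : TwoSidedIdeal B) :
    lift he (trace he J) = J := by
  refine TwoSidedIdeal.ext fun b => ?_
  rw [mem_lift]
  simp only [mem_trace]
  constructor
  · intro h
    rw [eq_sum_compress he hfull b]
    exact J.finsetSum_mem _ _ fun i _ => J.finsetSum_mem _ _ fun j _ =>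
      J.mul_mem_right _ _ (J.mul_mem_left _ _ (h _ _))
  · exact fun h a b => J.mul_mem_right _ _ (J.mul_mem_left _ _
      (J.mul_mem_right _ _ (J.mul_mem_left _ _ h)))

theorem encard_maximalTwoSidedIdeals (hfull : ∑ i ∈ s, x i * e * y i = 1) :
    (maximalTwoSidedIdeals B).encard = (maximalTwoSidedIdeals he.Corner).encard := by
  refine encard_setOf_isCoatom_eq (p := fun _ => True) (q := fun _ => True) (F := trace he)
    (H := lift he) (fun I J h a ha => ?_) (fun I J h a ha => ?_) (fun _ _ => trivial)
    (fun _ _ => trivial) trivial trivial (fun _ _ _ _ => trivial) (fun _ _ _ _ => trivial)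
    (fun _ _ => trivial) (fun _ _ => trivial) (fun J _ => lift_trace he hfull J)
    (fun J _ => trace_lift he J)
  · exact (mem_trace he).2 (h ((mem_trace he).1 ha))
  · exact (mem_lift he).2 fun x y => h ((mem_lift he).1 ha x y)

/-- Both `trace` and `lift` preserve the condition `J J ⊆ zⁿ J`, by the coordinate formulas.
Divisibility by `zⁿ` can likewise be tested on the coordinates. -/
theorem noProperOverring_iff (hfull : ∑ i ∈ s, x i * e * y i = 1) {z : B}
    (hz : ∀ b, Commute z b) {w : he.Corner} (hw : w.val = z * e) :
    NoProperOverring z ↔ NoProperOverring w := by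
  have hzn (n : ℕ) (b : B) : z ^ n * b = b * z ^ n := ((hz b).pow_left n).eq
  have hwn (n : ℕ) : (w ^ n).val = z ^ n * e := by
    induction n with
    | zero => rw [pow_zero, pow_zero, one_mul, val_one]
    | succ n ih =>
      rw [pow_succ, val_mul, ih, hw, pow_succ, ← mul_assoc, mul_assoc (z ^ n) e z, ← (hz e).eq]
      simp only [mul_assoc, he.eq]
  have hwn' (n : ℕ) (c : he.Corner) : (w ^ n * c).val = z ^ n * c.val := by
    rw [val_mul, hwn, mul_assoc, c.val_mem.1]
  have hcomp (n : ℕ) (b : B) : (compress he (z ^ n * b)) = w ^ n * compress he b :=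
    val_injective he (by
      rw [hwn', val_compress, val_compress, ← mul_assoc e, ← hzn n e]
      simp only [mul_assoc])
  constructor
  · intro hB n J hn hJ a ha
    have hmem (i : B) (j : B) (c : he.Corner) (hc : c ∈ J) : i * c.val * j ∈ lift he J :=
      (lift he J).mul_mem_right _ _ ((lift he J).mul_mem_left _ _ ((val_mem_lift_iff he).2 hc))
    obtain ⟨c, hc⟩ := hB n (lift he J)
      ((mem_lift he).2 fun a b => by
        rw [← hzn, mul_assoc, hcomp]
        exact J.mul_mem_right _ _ hn)
      (fun a ha b hb => by
        rw [mem_lift] at ha hb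
        -- Every coordinate of `a b` is a sum of products of two elements of `J`, and each such
        -- product lies in `wⁿ J`.
        have key (p q : B) : ∃ c ∈ J, compress he (p * (a * b) * q) = w ^ n * c := by
          have h (m : ι) : ∃ c ∈ J,
              compress he (p * a * x m) * compress he (y m * b * q) = w ^ n * c :=
            hJ _ (ha p (x m)) _ (hb (y m) q)
          choose c hcJ hc using h
          refine ⟨∑ m ∈ s, c m, J.finsetSum_mem _ _ fun m _ => hcJ m, ?_⟩
          rw [compress_mul_mul_eq_sum he hfull, Finset.mul_sum]
          exact Finset.sum_congr rfl fun m _ => hc m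
        choose c hcJ hc using key
        -- The cofactor is reassembled from the cofactors of the coordinates of `a b`.
        refine ⟨∑ i ∈ s, ∑ j ∈ s, x i * (c (y i) (x j)).val * y j,
          (lift he J).finsetSum_mem _ _ fun i _ => (lift he J).finsetSum_mem _ _ fun j _ =>
            hmem _ _ _ (hcJ _ _), ?_⟩
        rw [Finset.mul_sum]
        simp only [Finset.mul_sum]
        conv_lhs => rw [eq_sum_compress he hfull (a * b)]
        refine Finset.sum_congr rfl fun i _ => Finset.sum_congr rfl fun j _ => ?_
        rw [hc, hwn', ← mul_assoc (x i), ← hzn]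
        simp only [mul_assoc])
      a.val ((val_mem_lift_iff he).2 ha)
    refine ⟨compress he c, ?_⟩
    rw [← compress_val he a, hc, hcomp]
  · intro hE n J hn hJ a ha
    have key (b : B) (hb : b ∈ J) : ∃ c, (compress he b).val = z ^ n * c := by
      obtain ⟨c, hc⟩ := hE n (trace he J)
        ((mem_trace he).2 (by rw [hwn]; exact J.mul_mem_right _ _ hn))
        (fun a ha b hb => by
          rw [mem_trace] at ha hb
          obtain ⟨c, hc, h⟩ := hJ _ ha _ hb
          refine ⟨compress he c, (mem_trace he).2
            (J.mul_mem_right _ _ (J.mul_mem_left _ _ hc)), ?_⟩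
          rw [← compress_val he (a * b), val_mul, h, hcomp])
        (compress he b) ((mem_trace he).2 (J.mul_mem_right _ _ (J.mul_mem_left _ _ hb)))
      exact ⟨c.val, by rw [hc, hwn']⟩
    have key' (i j : ι) : ∃ c, (compress he (y i * a * x j)).val = z ^ n * c :=
      key _ (J.mul_mem_right _ _ (J.mul_mem_left _ _ ha))
    choose c hc using key'
    refine ⟨∑ i ∈ s, ∑ j ∈ s, x i * c i j * y j, ?_⟩
    rw [Finset.mul_sum]
    simp only [Finset.mul_sum]
    conv_lhs => rw [eq_sum_compress he hfull a]
    refine Finset.sum_congr rfl fun i _ => Finset.sum_congr rfl fun j _ => ?_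
    rw [hc, ← mul_assoc (x i), ← hzn]
    simp only [mul_assoc]

end IsIdempotentElem.Corner

/-! ## Maximal two-sided ideals of module-finite algebras over local rings -/

section LocalRing

variable {R A : Type*} [CommRing R] [IsLocalRing R] [Ring A] [Algebra R A] [Module.Finite R A]

/-- A two-sided ideal of an `R`-algebra as a submodule. -/
def TwoSidedIdeal.toSubmodule (R : Type*) [CommRing R] {A : Type*} [Ring A] [Algebra R A]
    (I : TwoSidedIdeal A) : Submodule R A where
  carrier := {a | a ∈ I}
  add_mem' h h' := I.add_mem h h'
  zero_mem' := I.zero_mem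
  smul_mem' r a h := by
    rw [Algebra.smul_def]
    exact I.mul_mem_left _ _ h

theorem TwoSidedIdeal.mem_toSubmodule {R A : Type*} [CommRing R] [Ring A] [Algebra R A]
    {I : TwoSidedIdeal A} {a : A} : a ∈ I.toSubmodule R ↔ a ∈ I := Iff.rfl

/-- Otherwise `M + rA = A` by maximality, and Nakayama's lemma over the local ring `R` gives `M =
A`. -/
theorem algebraMap_mem_of_mem_maximalTwoSidedIdeals {M : TwoSidedIdeal A}
    (hM : M ∈ maximalTwoSidedIdeals A) {r : R} (hr : r ∈ IsLocalRing.maximalIdeal R) :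
    algebraMap R A r ∈ M := by
  by_contra hrM
  let N : TwoSidedIdeal A := TwoSidedIdeal.mk' {a | ∃ m ∈ M, ∃ c, a = m + r • c}
    ⟨0, M.zero_mem, 0, by simp⟩
    (by
      rintro _ _ ⟨m, hm, c, rfl⟩ ⟨m', hm', c', rfl⟩
      exact ⟨m + m', M.add_mem hm hm', c + c', by rw [smul_add]; abel⟩)
    (by
      rintro _ ⟨m, hm, c, rfl⟩
      exact ⟨-m, M.neg_mem hm, -c, by rw [smul_neg]; abel⟩)
    (by
      rintro y _ ⟨m, hm, c, rfl⟩
      exact ⟨y * m, M.mul_mem_left _ _ hm, y * c, by rw [mul_add, mul_smul_comm]⟩)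
    (by
      rintro _ y ⟨m, hm, c, rfl⟩
      exact ⟨m * y, M.mul_mem_right _ _ hm, c * y, by rw [add_mul, smul_mul_assoc]⟩)
  have hN {a : A} : a ∈ N ↔ ∃ m ∈ M, ∃ c, a = m + r • c := TwoSidedIdeal.mem_mk' ..
  have hlt : M < N := by
    refine lt_of_le_of_ne (fun a ha => hN.2 ⟨a, ha, 0, by simp⟩) fun h => hrM ?_
    rw [h]
    exact hN.2 ⟨0, M.zero_mem, 1, by rw [Algebra.algebraMap_eq_smul_one, zero_add]⟩
  have htop := hM.2 N hlt
  have hle : (⊤ : Submodule R A) ≤ M.toSubmodule R ⊔ IsLocalRing.maximalIdeal R • ⊤ := by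
    intro a _
    obtain ⟨m, hm, c, rfl⟩ := hN.1 (htop ▸ trivial : a ∈ N)
    exact Submodule.add_mem_sup hm (Submodule.smul_mem_smul hr trivial)
  have hMtop := Submodule.le_of_le_smul_of_le_jacobson_bot (Module.Finite.fg_top)
    (IsLocalRing.jacobson_eq_maximalIdeal ⊥ bot_ne_top).ge hle
  exact hM.1 (top_le_iff.1 fun a _ => hMtop (trivial : a ∈ (⊤ : Submodule R A)))

/-- Distinct maximal ideals are comaximal, so each `M i` contains an element congruent to `1` modulo
`N`; the product of these elements works. -/
theorem TwoSidedIdeal.exists_mem_forall_one_sub_mem {ι : Type*} {M : ι → TwoSidedIdeal A}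
    {N : TwoSidedIdeal A} (hN : IsCoatom N) (s : Finset ι)
    (hM : ∀ i ∈ s, IsCoatom (M i) ∧ M i ≠ N) :
    ∃ x, (∀ i ∈ s, x ∈ M i) ∧ 1 - x ∈ N := by
  classical
  induction s using Finset.induction_on with
  | empty => exact ⟨1, by simp, by rw [sub_self]; exact N.zero_mem⟩
  | insert i s hi ih =>
    obtain ⟨x, hx, hxN⟩ := ih fun j hj => hM j (Finset.mem_insert_of_mem hj)
    obtain ⟨hi1, hi2⟩ := hM i (Finset.mem_insert_self i s)
    have h1 : (1 : A) ∈ M i ⊔ N := by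
      rw [hi1.sup_eq_top_of_ne hN hi2]
      trivial
    obtain ⟨y, hy, w, hw, hyw⟩ := TwoSidedIdeal.mem_sup.1 h1
    refine ⟨x * y, fun j hj => ?_, ?_⟩
    · rcases Finset.mem_insert.1 hj with rfl | hj
      · exact (M j).mul_mem_left _ _ hy
      · exact (M j).mul_mem_right _ _ (hx j hj)
    · have : 1 - x * y = (1 - x) + x * w := by
        have hw : w = 1 - y := by rw [← hyw, add_sub_cancel_left]
        rw [hw, mul_sub, mul_one]
        abel
      rw [this]
      exact N.add_mem hxN (N.mul_mem_left _ _ hw)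

/-- A module-finite algebra over a local ring has finitely many maximal two-sided ideals. -/
theorem finite_maximalTwoSidedIdeals (R : Type*) {A : Type*} [CommRing R] [IsLocalRing R]
    [Ring A] [Algebra R A] [Module.Finite R A] : (maximalTwoSidedIdeals A).Finite := by
  by_contra hinf
  let M := Set.Infinite.natEmbedding _ hinf
  let P : Submodule R A := IsLocalRing.maximalIdeal R • ⊤
  -- The intersections of the first `n` members of an infinite family form a decreasing chain. All
  -- of them contain `P`, so the chain stabilizes in the Artinian module `A ⧸ P`.
  let D : ℕ → Submodule R A := fun n => ⨅ i ∈ Finset.range n, (M i).1.toSubmodule R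
  have hD (n : ℕ) (x : A) : x ∈ D n ↔ ∀ i ∈ Finset.range n, x ∈ (M i).1 := by
    simp only [D, Submodule.mem_iInf, TwoSidedIdeal.mem_toSubmodule]
  have hPD (n : ℕ) : P ≤ D n := by
    refine Submodule.smul_le.2 fun r hr a _ => (hD n _).2 fun i _ => ?_
    rw [Algebra.smul_def]
    exact (M i).1.mul_mem_right _ _ (algebraMap_mem_of_mem_maximalTwoSidedIdeals (M i).2 hr)
  have : IsArtinian R (A ⧸ P) := by
    let : Field (R ⧸ IsLocalRing.maximalIdeal R) := Ideal.Quotient.field _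
    have : Module.Finite (R ⧸ IsLocalRing.maximalIdeal R) (A ⧸ P) :=
      Module.Finite.of_restrictScalars_finite R _ _
    exact isArtinian_of_surjective_algebraMap
      (Ideal.Quotient.mk_surjective (I := IsLocalRing.maximalIdeal R))
  obtain ⟨n, hn⟩ := IsArtinian.monotone_stabilizes (R := R) (M := A ⧸ P)
    ⟨fun n => OrderDual.toDual ((D n).map P.mkQ), fun m n hmn => Submodule.map_mono fun x hx =>
      (hD m x).2 fun i hi => (hD n x).1 hx i
        (Finset.mem_range.2 ((Finset.mem_range.1 hi).trans_le hmn))⟩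
  have heq : D n = D (n + 1) := by
    have h := congrArg (Submodule.comap P.mkQ) (OrderDual.toDual.injective (hn (n + 1) n.le_succ))
    simp only [Submodule.comap_map_mkQ, sup_eq_right.2 (hPD _)] at h
    exact h
  -- This `x` lies in the first `n` ideals and is `1` modulo the next one, whereas `heq` forces it
  -- into the next one too.
  obtain ⟨x, hx, hxN⟩ := TwoSidedIdeal.exists_mem_forall_one_sub_mem (M := fun i => (M i).1)
    (M n).2 (Finset.range n) fun i hi => ⟨(M i).2, fun h =>
      (Finset.mem_range.1 hi).ne (M.injective (Subtype.ext h))⟩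
  have hxn : x ∈ (M n).1 :=
    (hD (n + 1) x).1 (heq ▸ (hD n x).2 hx) n (Finset.mem_range.2 n.lt_succ_self)
  exact (M n).2.1 ((TwoSidedIdeal.one_mem_iff _).1
    (by simpa using (M n).1.add_mem hxN hxn))

end LocalRing

/-! ## Completions over a discrete valuation ring -/

section DVRCompletion

open IsLocalRing

variable {R : Type*} [CommRing R] [IsDomain R] [IsDiscreteValuationRing R] {ϖ : R}

theorem mem_maximalIdeal_pow_smul_top_iff {M : Type*} [AddCommGroup M] [Module R M]
    (hϖ : Irreducible ϖ) (n : ℕ) {x : M} :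
    x ∈ (maximalIdeal R ^ n • ⊤ : Submodule R M) ↔ ∃ y, x = ϖ ^ n • y := by
  rw [hϖ.maximalIdeal_eq, Ideal.span_singleton_pow, Submodule.ideal_span_singleton_smul,
    Submodule.mem_smul_pointwise_iff_exists]
  simp only [Submodule.mem_top, true_and, eq_comm]

namespace AdicCompletion

variable {M : Type*} [AddCommGroup M] [Module R M]

/-- The maximal ideal is finitely generated, so the kernel of the `n`-th projection is its `n`-th
power times the completion. -/
theorem exists_eq_pow_smul_of_val_eq_zero (hϖ : Irreducible ϖ) {n : ℕ}
    {x : AdicCompletion (maximalIdeal R) M} (hx : x.val n = 0) : ∃ y, x = ϖ ^ n • y := by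
  rw [← mem_maximalIdeal_pow_smul_top_iff hϖ,
    pow_smul_top_eq_ker_eval (maximalIdeal R).fg_of_isNoetherianRing]
  exact hx

theorem val_pow_smul_eq_zero (hϖ : Irreducible ϖ) (n : ℕ)
    (y : AdicCompletion (maximalIdeal R) M) : (ϖ ^ n • y).val n = 0 := by
  obtain ⟨a, ha⟩ := Submodule.Quotient.mk_surjective _ (y.val n)
  rw [val_smul_apply, ← ha, ← Submodule.Quotient.mk_smul, Submodule.Quotient.mk_eq_zero,
    mem_maximalIdeal_pow_smul_top_iff hϖ]
  exact ⟨a, rfl⟩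

theorem eq_zero_of_pow_smul_eq_zero [Module.IsTorsionFree R M] (hϖ : Irreducible ϖ) {n : ℕ}
    {x : AdicCompletion (maximalIdeal R) M} (hx : ϖ ^ n • x = 0) : x = 0 := by
  refine AdicCompletion.ext fun m => ?_
  -- Dividing by `ϖⁿ` costs `n` levels of precision, so the component at `n + m` is used to control
  -- the one at `m`.
  obtain ⟨a, ha⟩ := Submodule.Quotient.mk_surjective _ (x.val (n + m))
  have h : (ϖ ^ n • x).val (n + m) = 0 := by rw [hx]; rfl
  rw [val_smul_apply, ← ha, ← Submodule.Quotient.mk_smul, Submodule.Quotient.mk_eq_zero,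
    mem_maximalIdeal_pow_smul_top_iff hϖ] at h
  obtain ⟨y, hy⟩ := h
  rw [pow_add, mul_smul] at hy
  have hy' := smul_right_injective M (pow_ne_zero n hϖ.ne_zero) hy
  rw [← x.property (Nat.le_add_left m n), ← ha]
  refine (Submodule.Quotient.mk_eq_zero _).2 ((mem_maximalIdeal_pow_smul_top_iff hϖ m).2 ⟨y, hy'⟩)

/-- The valuation `n` of `x` is the last index with vanishing component. After division by `ϖⁿ`, a
nonunit quotient would be divisible by `ϖ` once more, and the next component of `x` would vanish.
The factorization yields both the domain and the discrete valuation property of `RHat R`. -/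
theorem exists_eq_pow_smul_unit (hϖ : Irreducible ϖ) {x : RHat R} (hx : x ≠ 0) :
    ∃ (n : ℕ) (u : (RHat R)ˣ), x = ϖ ^ n • (u : RHat R) := by
  classical
  have hex : ∃ n, x.val n ≠ 0 := by
    by_contra! h
    exact hx (AdicCompletion.ext h)
  -- The component at `0` lives in the zero module, so the first nonvanishing index is positive.
  obtain ⟨n, hn⟩ : ∃ n, Nat.find hex = n + 1 := by
    refine Nat.exists_eq_succ_of_ne_zero fun h => Nat.find_spec hex ?_
    obtain ⟨a, ha⟩ := Submodule.Quotient.mk_surjective _ (x.val (Nat.find hex))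
    rw [← ha, Submodule.Quotient.mk_eq_zero, mem_maximalIdeal_pow_smul_top_iff hϖ, h]
    exact ⟨a, by simp⟩
  have h0 : x.val n = 0 := by
    by_contra h
    exact absurd (Nat.find_min' hex h) (by omega)
  obtain ⟨u, rfl⟩ := exists_eq_pow_smul_of_val_eq_zero hϖ h0
  have hu : IsUnit u := by
    by_contra h
    rw [← mem_nonunits_iff, ← mem_maximalIdeal, mem_maximalIdeal_iff_eval_one_eq_zero] at h
    obtain ⟨v, rfl⟩ := exists_eq_pow_smul_of_val_eq_zero hϖ h
    refine Nat.find_spec hex ?_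
    rw [hn, smul_smul, ← pow_add]
    exact val_pow_smul_eq_zero hϖ _ v
  obtain ⟨u, rfl⟩ := hu
  exact ⟨n, u, rfl⟩

instance : IsDomain (RHat R) := by
  obtain ⟨ϖ, hϖ⟩ := IsDiscreteValuationRing.exists_irreducible R
  have : NoZeroDivisors (RHat R) := ⟨fun {x y} hxy => by
    by_contra! h
    obtain ⟨n, u, rfl⟩ := exists_eq_pow_smul_unit hϖ h.1
    obtain ⟨m, v, rfl⟩ := exists_eq_pow_smul_unit hϖ h.2
    rw [smul_mul_smul_comm, ← pow_add] at hxy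
    exact (u * v).ne_zero (eq_zero_of_pow_smul_eq_zero hϖ hxy)⟩
  exact NoZeroDivisors.to_isDomain _

theorem irreducible_algebraMap (hϖ : Irreducible ϖ) : Irreducible (algebraMap R (RHat R) ϖ) := by
  have h0 : algebraMap R (RHat R) ϖ ≠ 0 := fun h => by
    rw [Algebra.algebraMap_eq_smul_one, ← pow_one ϖ] at h
    exact one_ne_zero (eq_zero_of_pow_smul_eq_zero hϖ h)
  have hmax : maximalIdeal (RHat R) = Ideal.span {algebraMap R (RHat R) ϖ} := by
    rw [maximalIdeal_eq_map, ← Set.image_singleton, ← Ideal.map_span, ← hϖ.maximalIdeal_eq]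
  exact ((Ideal.span_singleton_prime h0).1 (hmax ▸ inferInstance)).irreducible

instance : IsDiscreteValuationRing (RHat R) := by
  obtain ⟨ϖ, hϖ⟩ := IsDiscreteValuationRing.exists_irreducible R
  refine IsDiscreteValuationRing.ofHasUnitMulPowIrreducibleFactorization
    ⟨_, irreducible_algebraMap hϖ, fun {x} hx => ?_⟩
  obtain ⟨n, u, rfl⟩ := exists_eq_pow_smul_unit hϖ hx
  exact ⟨n, u, by rw [← map_pow, Algebra.smul_def]⟩

end AdicCompletion

namespace AlgCompletion

variable {A : Type*} [Ring A] [Algebra R A]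

theorem algebraMap_algebraMap {R : Type*} [CommRing R] {I : Ideal R} {A : Type*} [Ring A]
    [Algebra R A] (r : R) :
    algebraMap (AdicCompletion I R) (AlgCompletion I A) (algebraMap R _ r) =
      of I A (algebraMap R A r) := by
  ext n
  rw [Algebra.algebraMap_eq_smul_one, comp_of, Algebra.algebraMap_eq_smul_one (A := A)]
  rfl

/-- A bridge to the results on modules: multiplication by a scalar in the ring `AlgCompletion` is
compared with the `R`-action on the underlying `AdicCompletion`. -/
theorem algebraMap_mul_eq {R : Type*} [CommRing R] {I : Ideal R} {A : Type*} [Ring A]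
    [Algebra R A] (r : R) (x : AlgCompletion I A) :
    of I A (algebraMap R A r) * x = (r • (show AdicCompletion I A from x) : AdicCompletion I A) := by
  ext n
  obtain ⟨a, ha⟩ := exists_comp_eq n x
  rw [comp_mul, comp_of, ha, quotMul_mk, ← Algebra.smul_def]
  change _ = r • comp n x
  rw [ha]
  rfl

instance [Module.Finite R A] : Module.Finite (RHat R) (AlgCompletion (maximalIdeal R) A) :=
  Module.Finite.of_surjective (AdicCompletion.ofTensorProduct (maximalIdeal R) A)
    (AdicCompletion.ofTensorProduct_surjective_of_finite (maximalIdeal R) A)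

theorem commute_of_algebraMap (r : R) (x : AlgCompletion (maximalIdeal R) A) :
    Commute (of (maximalIdeal R) A (algebraMap R A r)) x := by
  rw [← algebraMap_algebraMap]
  exact Algebra.commutes _ _

theorem of_pow_mul_left_cancel [Module.IsTorsionFree R A] (hϖ : Irreducible ϖ) {n : ℕ}
    {x y : AlgCompletion (maximalIdeal R) A}
    (h : of _ A (algebraMap R A ϖ) ^ n * x = of _ A (algebraMap R A ϖ) ^ n * y) : x = y := by
  rw [← sub_eq_zero, ← mul_sub, ← map_pow, ← map_pow, algebraMap_mul_eq] at h
  exact sub_eq_zero.1 (AdicCompletion.eq_zero_of_pow_smul_eq_zero hϖ h)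

instance [Module.IsTorsionFree R A] :
    Module.IsTorsionFree (RHat R) (AlgCompletion (maximalIdeal R) A) where
  isSMulRegular r hr := by
    obtain ⟨ϖ, hϖ⟩ := IsDiscreteValuationRing.exists_irreducible R
    obtain ⟨n, u, rfl⟩ := AdicCompletion.exists_eq_pow_smul_unit hϖ hr.ne_zero
    intro x y hxy
    simp only [Algebra.smul_def, map_pow, map_mul, mul_assoc, algebraMap_algebraMap] at hxy
    have := of_pow_mul_left_cancel hϖ hxy
    rw [← Algebra.smul_def, ← Algebra.smul_def] at this
    exact u.isUnit.smul_left_cancel.1 this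

theorem exists_eq_pow_mul_of_comp_eq_zero (hϖ : Irreducible ϖ) {n : ℕ}
    {x : AlgCompletion (maximalIdeal R) A} (hx : comp n x = 0) :
    ∃ y, x = of _ A (algebraMap R A ϖ) ^ n * y := by
  obtain ⟨y, hy⟩ := AdicCompletion.exists_eq_pow_smul_of_val_eq_zero (M := A) hϖ (x := x) hx
  let y' : AlgCompletion (maximalIdeal R) A := y
  refine ⟨y', ?_⟩
  rw [← map_pow, ← map_pow]
  exact hy.trans (algebraMap_mul_eq (ϖ ^ n) y').symm

theorem comp_pow_mul_eq_zero (hϖ : Irreducible ϖ) (n : ℕ) (y : AlgCompletion (maximalIdeal R) A) :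
    comp n (of _ A (algebraMap R A ϖ) ^ n * y) = 0 := by
  rw [← map_pow, ← map_pow, algebraMap_mul_eq]
  exact AdicCompletion.val_pow_smul_eq_zero (M := A) hϖ n y

theorem comp_sub {R : Type*} [CommRing R] {I : Ideal R} {A : Type*} [Ring A]
    [Algebra R A] (n : ℕ) (x y : AlgCompletion I A) : comp n (x - y) = comp n x - comp n y := rfl

theorem exists_eq_of_add_pow_mul (hϖ : Irreducible ϖ) (n : ℕ)
    (x : AlgCompletion (maximalIdeal R) A) :
    ∃ a y, x = of _ A a + of _ A (algebraMap R A ϖ) ^ n * y := by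
  obtain ⟨a, ha⟩ := exists_comp_eq n x
  obtain ⟨y, hy⟩ := exists_eq_pow_mul_of_comp_eq_zero hϖ (x := x - of _ A a)
    (by rw [comp_sub, ha, comp_of, sub_self])
  exact ⟨a, y, by rw [← hy]; abel⟩

theorem exists_eq_pow_mul_of_of_eq (hϖ : Irreducible ϖ) (n : ℕ) (a : A)
    (y : AlgCompletion (maximalIdeal R) A)
    (h : of (maximalIdeal R) A a = of _ A (algebraMap R A ϖ) ^ n * y) :
    ∃ a', a = algebraMap R A ϖ ^ n * a' := by
  have h0 : comp n (of (maximalIdeal R) A a) = 0 := by rw [h]; exact comp_pow_mul_eq_zero hϖ n y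
  rw [comp_of, Submodule.Quotient.mk_eq_zero, mem_maximalIdeal_pow_smul_top_iff hϖ] at h0
  obtain ⟨a', rfl⟩ := h0
  exact ⟨a', by rw [Algebra.smul_def, map_pow]⟩

variable (A) in
theorem noProperOverring_iff [Module.IsTorsionFree R A] (hϖ : Irreducible ϖ) :
    NoProperOverring (algebraMap R A ϖ) ↔
      NoProperOverring (algebraMap (RHat R) (AlgCompletion (maximalIdeal R) A)
        (algebraMap R (RHat R) ϖ)) := by
  rw [algebraMap_algebraMap]
  exact noProperOverring_iff_of_dense (commute_of_algebraMap ϖ)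
    (fun _ _ _ h => of_pow_mul_left_cancel hϖ h) (exists_eq_of_add_pow_mul hϖ)
    (exists_eq_pow_mul_of_of_eq hϖ)

variable (R A) in
theorem encard_maximalTwoSidedIdeals [Module.Finite R A] :
    (maximalTwoSidedIdeals A).encard =
      (maximalTwoSidedIdeals (AlgCompletion (maximalIdeal R) A)).encard := by
  obtain ⟨ϖ, hϖ⟩ := IsDiscreteValuationRing.exists_irreducible R
  refine encard_maximalTwoSidedIdeals_eq_of_dense (φ := of (maximalIdeal R) A)
    (commute_of_algebraMap ϖ)
    (fun x => by simpa only [pow_one] using exists_eq_of_add_pow_mul hϖ 1 x)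
    (fun a y h => by
      simpa only [pow_one] using exists_eq_pow_mul_of_of_eq hϖ 1 a y (by rwa [pow_one]))
    (fun M hM => algebraMap_mem_of_mem_maximalTwoSidedIdeals hM
      ((mem_maximalIdeal _).2 hϖ.not_isUnit)) (fun M hM => ?_)
  rw [← algebraMap_algebraMap]
  exact algebraMap_mem_of_mem_maximalTwoSidedIdeals hM
      ((mem_maximalIdeal _).2 (AdicCompletion.irreducible_algebraMap hϖ).not_isUnit)

end AlgCompletion

end DVRCompletion

noncomputable section

/-! ## Coefficients in the completed crossed product -/

namespace AlgCompletion

variable {R : Type*} [CommRing R] (I : Ideal R) {A B : Type*} [Ring A] [Algebra R A]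
  [Ring B] [Algebra R B]

/-- The extension of a linear map to the completions. -/
def mapOfLinear (φ : A →ₗ[R] B) :
    AlgCompletion I A →ₗ[AdicCompletion I R] AlgCompletion I B :=
  AdicCompletion.map I φ

theorem comp_mapOfLinear (φ : A →ₗ[R] B) (n : ℕ) (x : AlgCompletion I A) {a : A}
    (ha : comp n x = Submodule.Quotient.mk a) :
    comp n (mapOfLinear I φ x) = Submodule.Quotient.mk (φ a) := by
  have h : comp n (mapOfLinear I φ x) = Submodule.mapQ _ _ φ
    (Submodule.smul_top_le_comap_smul_top (I ^ n) φ) (comp n x) := rfl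
  rw [h, ha, Submodule.mapQ_apply]

theorem mapOfLinear_of (φ : A →ₗ[R] B) (a : A) : mapOfLinear I φ (of I A a) = of I B (φ a) := by
  ext n
  rw [comp_mapOfLinear I φ n _ (comp_of n a), comp_of]

theorem mapOfLinear_comp {C : Type*} [Ring C] [Algebra R C] (ψ : B →ₗ[R] C) (φ : A →ₗ[R] B)
    (x : AlgCompletion I A) : mapOfLinear I (ψ ∘ₗ φ) x = mapOfLinear I ψ (mapOfLinear I φ x) := by
  ext n
  obtain ⟨a, ha⟩ := exists_comp_eq n x
  rw [comp_mapOfLinear I _ n _ ha, comp_mapOfLinear I _ n _ (comp_mapOfLinear I _ n _ ha)]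
  rfl

theorem mapOfLinear_id (x : AlgCompletion I A) : mapOfLinear I LinearMap.id x = x := by
  ext n
  obtain ⟨a, ha⟩ := exists_comp_eq n x
  rw [comp_mapOfLinear I _ n _ ha, ha]
  rfl

theorem mapOfLinear_zero (x : AlgCompletion I A) :
    mapOfLinear I (0 : A →ₗ[R] B) x = 0 := by
  ext n
  obtain ⟨a, ha⟩ := exists_comp_eq n x
  rw [comp_mapOfLinear I _ n _ ha]
  rfl

theorem mapOfLinear_sum {ι : Type*} (s : Finset ι) (φ : ι → A →ₗ[R] B) (x : AlgCompletion I A) :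
    mapOfLinear I (∑ i ∈ s, φ i) x = ∑ i ∈ s, mapOfLinear I (φ i) x := by
  let compHom (n : ℕ) : AlgCompletion I B →+ (B ⧸ (I ^ n • ⊤ : Submodule R B)) :=
    ⟨⟨comp n, rfl⟩, fun _ _ => rfl⟩
  ext n
  obtain ⟨a, ha⟩ := exists_comp_eq n x
  have h := map_sum (compHom n) (fun i => mapOfLinear I (φ i) x) s
  change comp n _ = ∑ i ∈ s, comp n (mapOfLinear I (φ i) x) at h
  rw [h, comp_mapOfLinear I _ n _ ha, LinearMap.sum_apply]
  simp only [comp_mapOfLinear I _ n _ ha]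
  exact map_sum (Submodule.mkQ (I ^ n • ⊤ : Submodule R B)) _ s

end AlgCompletion

namespace CrossedProduct

open AlgCompletion

variable {G S : Type*} [Group G] [CommRing S] [MulSemiringAction G S] {f : TwoCocycle G S}
  {R : Type*} [CommRing R] [Algebra R S]

/-- The coefficient at `g` as a linear map. -/
def coeffLinear (R : Type*) [CommRing R] [Algebra R S] (f : TwoCocycle G S) (g : G) :
    CrossedProduct f →ₗ[R] S :=
  Finsupp.lapply (M := S) (R := R) g

/-- The map `s ↦ s U_g` as a linear map. -/
def singleLinear (R : Type*) [CommRing R] [Algebra R S] (f : TwoCocycle G S) (g : G) :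
    S →ₗ[R] CrossedProduct f :=
  Finsupp.lsingle (M := S) (R := R) g

theorem coeffLinear_single_same (g : G) (s : S) : coeffLinear R f g (single f g s) = s :=
  Finsupp.single_eq_same

theorem coeffLinear_single_of_ne {g h : G} (hgh : g ≠ h) (s : S) :
    coeffLinear R f h (single f g s) = 0 :=
  Finsupp.single_eq_of_ne hgh.symm

theorem sum_single_coeffLinear [Fintype G] (x : CrossedProduct f) :
    ∑ g, single f g (coeffLinear R f g x) = x :=
  Finsupp.univ_sum_single (M := S) x

instance [Module.Finite R S] [Finite G] : Module.Finite R (CrossedProduct f) :=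
  inferInstanceAs (Module.Finite R (G →₀ S))

instance [Module.IsTorsionFree R S] : Module.IsTorsionFree R (CrossedProduct f) :=
  inferInstanceAs (Module.IsTorsionFree R (G →₀ S))

instance {K : Type*} [CommRing K] [Algebra R K] [Algebra K S] [IsScalarTower R K S] :
    IsScalarTower R K (CrossedProduct f) :=
  inferInstanceAs (IsScalarTower R K (G →₀ S))

variable (I : Ideal R) [SMulCommClass G R S]

/-- The element `s U_g` of the completed crossed product. -/
def singleHat (f : TwoCocycle G S) (g : G) :
    AlgCompletion I S →ₗ[AdicCompletion I R] AlgCompletion I (CrossedProduct f) :=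
  mapOfLinear I (singleLinear R f g)

/-- The coefficients of an element of the completed crossed product. -/
def coeffHat (f : TwoCocycle G S) (g : G) :
    AlgCompletion I (CrossedProduct f) →ₗ[AdicCompletion I R] AlgCompletion I S :=
  mapOfLinear I (coeffLinear R f g)

theorem coeffHat_singleHat_same (g : G) (s : AlgCompletion I S) :
    coeffHat I f g (singleHat I f g s) = s := by
  rw [coeffHat, singleHat, ← mapOfLinear_comp]
  convert mapOfLinear_id I s
  exact LinearMap.ext fun s => coeffLinear_single_same (R := R) (f := f) g s

theorem coeffHat_singleHat_of_ne {g h : G} (hgh : g ≠ h) (s : AlgCompletion I S) :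
    coeffHat I f h (singleHat I f g s) = 0 := by
  rw [coeffHat, singleHat, ← mapOfLinear_comp]
  convert mapOfLinear_zero I s
  exact LinearMap.ext fun s => coeffLinear_single_of_ne (R := R) (f := f) hgh s

/-- Completion is additive on linear maps and `G` is finite, so the decomposition `T = ⨁ S U_g`
passes to `T̂ = ⨁ Ŝ U_g`. -/
theorem sum_singleHat_coeffHat [Fintype G] (x : AlgCompletion I (CrossedProduct f)) :
    ∑ g, singleHat I f g (coeffHat I f g x) = x := by
  simp only [coeffHat, singleHat, ← mapOfLinear_comp]
  rw [← mapOfLinear_sum]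
  convert mapOfLinear_id I x
  refine LinearMap.ext fun x => ?_
  rw [LinearMap.sum_apply]
  exact sum_single_coeffLinear x

theorem singleHat_of (g : G) (s : S) : singleHat I f g (of I S s) = of I _ (single f g s) :=
  mapOfLinear_of I _ s

theorem singleHat_mul_singleHat (g h : G) (s t : AlgCompletion I S) :
    singleHat I f g s * singleHat I f h t =
      singleHat I f (g * h) (s * g • t * of I S (f.val g h : S)) := by
  ext n
  obtain ⟨a, ha⟩ := exists_comp_eq n s
  obtain ⟨b, hb⟩ := exists_comp_eq n t
  have hgb : comp n (g • t) = Submodule.Quotient.mk (g • b) :=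
    comp_map (MulSemiringAction.toAlgHom R S g) n t hb
  have h1 : comp n (s * g • t * of I S (f.val g h : S)) =
      Submodule.Quotient.mk (a * g • b * (f.val g h : S)) := by
    rw [comp_mul, comp_mul, ha, hgb, comp_of, quotMul_mk, quotMul_mk]
  have h2 : comp n (singleHat I f g s) = Submodule.Quotient.mk (single f g a) :=
    comp_mapOfLinear I _ n _ ha
  have h3 : comp n (singleHat I f h t) = Submodule.Quotient.mk (single f h b) :=
    comp_mapOfLinear I _ n _ hb
  rw [comp_mul, h2, h3, quotMul_mk, single_mul_single]
  exact (comp_mapOfLinear I (singleLinear R f _) n _ h1).symm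

theorem map_coeffHom (s : AlgCompletion I S) :
    AlgCompletion.map I (coeffHom R f) s =
      singleHat I f 1 (s * of I S ((f.val 1 1)⁻¹ : Sˣ)) := by
  ext n
  obtain ⟨a, ha⟩ := exists_comp_eq n s
  have h1 : comp n (s * of I S ((f.val 1 1)⁻¹ : Sˣ)) =
      Submodule.Quotient.mk (a * ((f.val 1 1)⁻¹ : Sˣ)) := by
    rw [comp_mul, ha, comp_of, quotMul_mk]
  rw [comp_map _ n s ha]
  exact (comp_mapOfLinear I (singleLinear R f _) n _ h1).symm

theorem of_inv_mul (u : Sˣ) : of I S ((u⁻¹ : Sˣ) : S) * of I S (u : S) = 1 := by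
  rw [← map_mul, Units.inv_mul, map_one]

theorem map_coeffHom_mul_singleHat (a : AlgCompletion I S) (g : G) (s : AlgCompletion I S) :
    AlgCompletion.map I (coeffHom R f) a * singleHat I f g s = singleHat I f g (a * s) := by
  rw [map_coeffHom, singleHat_mul_singleHat, f.val_one_left, one_mul, one_smul]
  congr 1
  linear_combination a * s * of_inv_mul I (f.val 1 1)

/-- Moving a coefficient to the left past `U_g` applies `g` to it; this is how conjugation by `U_g`
carries `e` to `g • e`. -/
theorem singleHat_mul_map_coeffHom (a : AlgCompletion I S) (g : G) (s : AlgCompletion I S) :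
    singleHat I f g s * AlgCompletion.map I (coeffHom R f) a = singleHat I f g (s * g • a) := by
  rw [map_coeffHom, singleHat_mul_singleHat, f.val_one_right, mul_one, smul_mul', ← smul_of]
  congr 1
  have h := congrArg (g • ·) (of_inv_mul I (f.val 1 1))
  simp only [smul_mul', smul_one] at h
  linear_combination s * g • a * h

/-- Right multiplication by a suitable element carries `s U_g` to the image of `s`. -/
theorem exists_singleHat_mul_eq (g : G) : ∃ y : AlgCompletion I (CrossedProduct f),
    ∀ s, singleHat I f g s * y = AlgCompletion.map I (coeffHom R f) s := by
  -- This element is the inverse of `U_g`. The factor `f(g, g⁻¹)⁻¹` cancels the cocycle value of the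
  -- product, and `f(1,1)⁻¹` appears because the unit element is `f(1,1)⁻¹ U_1`.
  refine ⟨singleHat I f g⁻¹ (g⁻¹ • (of I S ((f.val g g⁻¹)⁻¹ : Sˣ) *
    of I S ((f.val 1 1)⁻¹ : Sˣ))), fun s => ?_⟩
  rw [singleHat_mul_singleHat, map_coeffHom, smul_inv_smul, mul_inv_cancel]
  congr 1
  linear_combination s * of I S ((f.val 1 1)⁻¹ : Sˣ) * of_inv_mul I (f.val g g⁻¹)

end CrossedProduct

/-! ## Primitive idempotents of the completion of the coefficient ring -/

section Idempotents

namespace IsPrimitiveIdempotent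

variable {C : Type*} [CommRing C] {e e' : C}

theorem smul {G : Type*} [Group G] [MulSemiringAction G C] (he : IsPrimitiveIdempotent e)
    (g : G) : IsPrimitiveIdempotent (g • e) where
  idem := by
    have := congrArg (g • ·) he.idem.eq
    rwa [smul_mul'] at this
  ne_zero h := he.ne_zero (by rw [← inv_smul_smul g e, h, smul_zero])
  eq_zero_or_eq a ha hae := by
    have h1 : IsIdempotentElem (g⁻¹ • a) := by
      have := congrArg (g⁻¹ • ·) ha.eq
      rwa [smul_mul'] at this
    have h2 : g⁻¹ • a * e = g⁻¹ • a := by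
      have := congrArg (g⁻¹ • ·) hae
      simpa only [smul_mul', inv_smul_smul] using this
    refine (he.eq_zero_or_eq _ h1 h2).imp (fun h => ?_) fun h => ?_
    · rw [← smul_inv_smul g a, h, smul_zero]
    · rw [← h, smul_inv_smul]

/-- The idempotent `e e'` lies below both `e` and `e'`; if it were nonzero, it would equal both. -/
theorem mul_eq_zero (he : IsPrimitiveIdempotent e) (he' : IsPrimitiveIdempotent e')
    (h : e ≠ e') : e * e' = 0 := by
  have hid : IsIdempotentElem (e * e') := he.idem.mul he'.idem
  rcases he.eq_zero_or_eq _ hid (by rw [mul_right_comm, he.idem.eq]) with h1 | h1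
  · exact h1
  · rcases he'.eq_zero_or_eq _ hid (by rw [mul_assoc, he'.idem.eq]) with h2 | h2
    · exact h2
    · exact absurd (h1.symm.trans h2) h

end IsPrimitiveIdempotent

open AlgCompletion IsLocalRing

variable {R S G : Type*} [CommRing R] [IsDomain R] [IsDiscreteValuationRing R] [CommRing S]
  [Algebra R S]

/-- Since `a` equals all its positive powers, it is divisible by every power of `ϖ`, and the
completion is separated. -/
theorem IsIdempotentElem.eq_zero_of_eq_mul {ϖ : R} (hϖ : Irreducible ϖ) {a w : SHat R S}
    (ha : IsIdempotentElem a) (h : a = of _ S (algebraMap R S ϖ) * w) : a = 0 := by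
  ext n
  have h1 : a = of _ S (algebraMap R S ϖ) ^ n * (w ^ n * a) := by
    rw [← mul_assoc, ← mul_pow, ← h, ← pow_succ, ha.pow_succ_eq]
  rw [h1, comp_pow_mul_eq_zero hϖ, comp_zero]

variable [Group G] [Finite G] [MulSemiringAction G S] [SMulCommClass G R S]
  [Algebra.IsInvariant R S G]

/-- Choose `s ∈ S` congruent to `ε` modulo `z`. By invariance of `ε`, the norm `r = ∏ g • s` is
congruent to a positive power of `ε`, hence to `ε`, and it lies in `R`. As `R` is local, either `r`
is a unit and `z` divides `1 - ε`, or `z` divides `r` and hence `ε`. An idempotent divisible by `z`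
is zero. -/
theorem eq_zero_or_eq_one_of_isIdempotentElem {ε : SHat R S} (hε : IsIdempotentElem ε)
    (hG : ∀ g : G, g • ε = ε) : ε = 0 ∨ ε = 1 := by
  obtain ⟨ϖ, hϖ⟩ := IsDiscreteValuationRing.exists_irreducible R
  have := Fintype.ofFinite G
  set z := of (maximalIdeal R) S (algebraMap R S ϖ)
  obtain ⟨s, y, hs⟩ := exists_eq_of_add_pow_mul hϖ 1 ε
  rw [pow_one] at hs
  obtain ⟨r, hr⟩ := Algebra.IsInvariant.isInvariant (A := R) (G := G) (∏ g : G, g • s) fun g => by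
    rw [Finset.smul_prod']
    simp only [smul_smul]
    exact Fintype.prod_equiv (Equiv.mulLeft g) _ _ fun _ => rfl
  have hmod : ∃ w, of (maximalIdeal R) S (algebraMap R S r) - ε = z * w := by
    change z ∣ _
    rw [← Ideal.mem_span_singleton, ← Ideal.Quotient.eq, hr, map_prod, map_prod]
    have h1 (g : G) : Ideal.Quotient.mk (Ideal.span {z}) (of (maximalIdeal R) S (g • s)) =
        Ideal.Quotient.mk _ ε := by
      rw [Ideal.Quotient.eq, Ideal.mem_span_singleton]
      refine ⟨-(g • y), ?_⟩
      have h2 := congrArg (g • ·) hs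
      simp only [hG, smul_add, smul_mul', smul_of] at h2
      rw [smul_algebraMap] at h2
      rw [h2]
      ring
    rw [Finset.prod_congr rfl fun g _ => h1 g, Finset.prod_const, ← map_pow,
      ← Nat.succ_pred_eq_of_pos (Finset.card_pos.2 Finset.univ_nonempty), hε.pow_succ_eq]
  obtain ⟨w, hw⟩ := hmod
  by_cases hu : IsUnit r
  · right
    obtain ⟨r', hr'⟩ := hu.exists_left_inv
    have h1 := congrArg (fun r => of (maximalIdeal R) S (algebraMap R S r)) hr'
    simp only [map_mul, map_one] at h1
    -- Because `ε (1 - ε) = 0`, one has `1 - ε = r' r (1 - ε) = r' (r - ε) (1 - ε)`, and `r - ε = z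
    -- w`.
    refine (sub_eq_zero.1 (hε.one_sub.eq_zero_of_eq_mul hϖ
      (w := of (maximalIdeal R) S (algebraMap R S r') * w * (1 - ε)) ?_)).symm
    have h2 := hε.eq
    linear_combination (-(1 - ε)) * h1 + of (maximalIdeal R) S (algebraMap R S r') * (1 - ε) * hw
      - of (maximalIdeal R) S (algebraMap R S r') * h2
  · left
    have hr' : r ∈ maximalIdeal R := (mem_maximalIdeal r).2 hu
    rw [hϖ.maximalIdeal_eq, Ideal.mem_span_singleton] at hr'
    obtain ⟨r', rfl⟩ := hr'
    refine hε.eq_zero_of_eq_mul hϖ (w := of (maximalIdeal R) S (algebraMap R S r') - w) ?_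
    rw [map_mul, map_mul] at hw
    linear_combination -hw

-- Distinct conjugates of `e` are orthogonal, so their sum is a `G`-invariant idempotent. It is
-- nonzero because its product with `e` is `e`. Summing over the orbit rather than over `G` counts
-- each conjugate once.
variable (G) in
theorem sum_orbit_eq_one {e : SHat R S} (he : IsPrimitiveIdempotent e) :
    ∑ x ∈ (Set.finite_range fun g : G => g • e).toFinset, x = 1 := by
  classical
  set s := (Set.finite_range fun g : G => g • e).toFinset
  have hs (x : SHat R S) : x ∈ s ↔ ∃ g : G, g • e = x := by
    simp only [s, Set.Finite.mem_toFinset, Set.mem_range]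
  have hprim {x : SHat R S} (hx : x ∈ s) : IsPrimitiveIdempotent x := by
    obtain ⟨g, rfl⟩ := (hs x).1 hx
    exact he.smul g
  have hmul {x : SHat R S} (hx : x ∈ s) : (∑ y ∈ s, y) * x = x := by
    rw [Finset.sum_mul, Finset.sum_eq_single_of_mem x hx fun y hy hyx =>
      (hprim hy).mul_eq_zero (hprim hx) hyx, (hprim hx).idem.eq]
  refine (eq_zero_or_eq_one_of_isIdempotentElem (G := G) (?_ : _ * _ = _)
    fun g => ?_).resolve_left fun h => ?_
  · rw [Finset.mul_sum]
    exact Finset.sum_congr rfl fun x hx => hmul hx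
  · rw [Finset.smul_sum]
    refine Finset.sum_bij (fun x _ => g • x) (fun x hx => ?_) (fun x _ y _ h => smul_left_cancel g h)
      (fun x hx => ?_) fun _ _ => rfl
    · obtain ⟨h, rfl⟩ := (hs x).1 hx
      exact (hs _).2 ⟨g * h, mul_smul g h e⟩
    · obtain ⟨h, rfl⟩ := (hs x).1 hx
      exact ⟨g⁻¹ • h • e, (hs _).2 ⟨g⁻¹ * h, mul_smul _ _ _⟩, smul_inv_smul _ _⟩
  · have := hmul ((hs e).2 ⟨1, one_smul G e⟩)
    rw [h, zero_mul] at this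
    exact he.ne_zero this.symm

end Idempotents

/-! ## The corner at a primitive idempotent -/

section Corner

open AlgCompletion CrossedProduct IsLocalRing

variable {R S G : Type*} [CommRing R] [IsDomain R] [IsDiscreteValuationRing R] [CommRing S]
  [Algebra R S] [Group G] [MulSemiringAction G S] [SMulCommClass G R S] (f : TwoCocycle G S)
  {e : SHat R S}

/-- The element `s U_g` of the corner `e T̂ e`, for `s ∈ Ŝ e` and `g` in the stabilizer of `e`. -/
def cornerSingle (he : IsIdempotentElem e) (g : MulAction.stabilizer G e) :
    he.Corner →ₗ[RHat R] TCorner f he where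
  toFun s := ⟨singleHat _ f (g : G) s.val, by
    have hg : (g : G) • e = e := g.2
    rw [Subsemigroup.mem_corner_iff (he.map (sHatToTHat R f)), map_coeffHom_mul_singleHat, singleHat_mul_map_coeffHom, hg,
      s.val_mem.1, s.val_mem.2]
    exact ⟨rfl, rfl⟩⟩
  map_add' s t := Subtype.ext (map_add (singleHat _ f (g : G)) s.val t.val)
  map_smul' r s := Subtype.ext (map_smul (singleHat _ f (g : G)) r s.val)

theorem val_cornerSingle (he : IsIdempotentElem e) (g : MulAction.stabilizer G e)
    (s : he.Corner) : (cornerSingle f he g s).val = singleHat _ f (g : G) s.val := rfl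

theorem val_cornerCocycle (he : IsIdempotentElem e) (g h : MulAction.stabilizer G e) :
    ((cornerCocycle f he).val g h : he.Corner).val =
      of (maximalIdeal R) S (f.val (g : G) (h : G) : S) * e := rfl

theorem val_inv_cornerCocycle (he : IsIdempotentElem e) (g h : MulAction.stabilizer G e) :
    (((cornerCocycle f he).val g h)⁻¹ : he.Cornerˣ).val.val =
      of (maximalIdeal R) S ((f.val (g : G) (h : G))⁻¹ : Sˣ) * e := rfl

/-- The homomorphism from the crossed product of the stabilizer of `e` over `Ŝ e` to `e T̂ e`, as
a linear map. -/
def cornerLinear (he : IsIdempotentElem e) :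
    CrossedProduct (cornerCocycle f he) →ₗ[RHat R] TCorner f he :=
  (Finsupp.lsum (RHat R) (M := he.Corner) (fun g => cornerSingle f he g) :
    (MulAction.stabilizer G e →₀ he.Corner) →ₗ[RHat R] TCorner f he)

theorem cornerLinear_single (he : IsIdempotentElem e) (g : MulAction.stabilizer G e)
    (s : he.Corner) : cornerLinear f he (single _ g s) = cornerSingle f he g s :=
  (Finsupp.lsum_single (RHat R) (M := he.Corner) (fun g => cornerSingle f he g) g s :)

theorem cornerLinear_one (he : IsIdempotentElem e) : cornerLinear f he 1 = 1 := by
  refine IsIdempotentElem.Corner.val_injective _ ?_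
  rw [one_def, cornerLinear_single, val_cornerSingle, val_inv_cornerCocycle,
    IsIdempotentElem.Corner.val_one, map_coeffHom, mul_comm]
  rfl

theorem cornerLinear_mul (he : IsIdempotentElem e) (x y : CrossedProduct (cornerCocycle f he)) :
    cornerLinear f he (x * y) = cornerLinear f he x * cornerLinear f he y := by
  induction x using CrossedProduct.induction_on with
  | zero => rw [zero_mul, map_zero, zero_mul]
  | add x x' hx hx' => rw [add_mul, map_add, map_add, hx, hx', add_mul]
  | single g s =>
  induction y using CrossedProduct.induction_on with
  | zero => rw [mul_zero, map_zero, mul_zero]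
  | add y y' hy hy' => rw [mul_add, map_add, map_add, hy, hy', mul_add]
  | single h t =>
    refine IsIdempotentElem.Corner.val_injective _ ?_
    rw [single_mul_single, cornerLinear_single, cornerLinear_single, cornerLinear_single,
      IsIdempotentElem.Corner.val_mul, val_cornerSingle, val_cornerSingle, val_cornerSingle,
      singleHat_mul_singleHat]
    congr 1
    rw [IsIdempotentElem.Corner.val_mul, IsIdempotentElem.Corner.val_mul, val_cornerCocycle]
    change s.val * (g : G) • t.val * _ = _
    have := s.val_mem.2
    linear_combination (g : G) • t.val * of (maximalIdeal R) S (f.val (g : G) (h : G) : S) * this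

/-- The homomorphism from the crossed product of the stabilizer of `e` over `Ŝ e` to `e T̂ e`. -/
def cornerAlgHom (he : IsIdempotentElem e) :
    CrossedProduct (cornerCocycle f he) →ₐ[RHat R] TCorner f he :=
  AlgHom.ofLinearMap (cornerLinear f he) (cornerLinear_one f he) (cornerLinear_mul f he)

theorem cornerAlgHom_single (he : IsIdempotentElem e) (g : MulAction.stabilizer G e)
    (s : he.Corner) : cornerAlgHom f he (single _ g s) = cornerSingle f he g s :=
  cornerLinear_single f he g s

/-- This reduces bijectivity of `cornerAlgHom` to a comparison of coefficients. -/
theorem coeffHat_val_cornerAlgHom (he : IsIdempotentElem e) (g : MulAction.stabilizer G e)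
    (x : CrossedProduct (cornerCocycle f he)) :
    coeffHat _ f (g : G) (cornerAlgHom f he x).val = (coeff _ g x).val := by
  classical
  induction x using CrossedProduct.induction_on with
  | zero =>
    rw [map_zero, map_zero, IsIdempotentElem.Corner.val_zero, IsIdempotentElem.Corner.val_zero,
      map_zero]
  | add x y hx hy =>
    rw [map_add, map_add, IsIdempotentElem.Corner.val_add, IsIdempotentElem.Corner.val_add,
      map_add, hx, hy]
  | single h s =>
    rw [cornerAlgHom_single, val_cornerSingle, coeff_single]
    split_ifs with hgh
    · rw [hgh, coeffHat_singleHat_same]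
    · rw [coeffHat_singleHat_of_ne _ (fun h => hgh (Subtype.ext h))]
      rfl

variable [Finite G]

theorem coeffHat_eq_of_mul_mul (a : SHat R S) (t : THat R f) (g : G) :
    coeffHat _ f g (sHatToTHat R f a * t * sHatToTHat R f a) = a * coeffHat _ f g t * g • a := by
  have := Fintype.ofFinite G
  conv_lhs => rw [← sum_singleHat_coeffHat (maximalIdeal R) t, Finset.mul_sum, Finset.sum_mul]
  simp only [map_coeffHom_mul_singleHat, singleHat_mul_map_coeffHom, map_sum]
  rw [Finset.sum_eq_single_of_mem g (Finset.mem_univ g)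
    fun h _ hhg => coeffHat_singleHat_of_ne _ hhg _, coeffHat_singleHat_same]

theorem coeffHat_val_eq (he : IsIdempotentElem e) (t : TCorner f he) (g : G) :
    coeffHat _ f g t.val = e * coeffHat _ f g t.val * g • e := by
  rw [← coeffHat_eq_of_mul_mul, t.val_mem.1, t.val_mem.2]

/-- An element of `e T̂ e` has coefficients in `e Ŝ g(e)`. Primitivity gives `e g(e) = 0` for `g`
outside the stabilizer, so only coefficients in `Ŝ e` at stabilizer elements survive. -/
theorem cornerAlgHom_bijective (he : IsPrimitiveIdempotent e) :
    Function.Bijective (cornerAlgHom f he.idem) := by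
  have := Fintype.ofFinite G
  constructor
  · intro x y hxy
    refine Finsupp.ext fun g => IsIdempotentElem.Corner.val_injective _ ?_
    exact (coeffHat_val_cornerAlgHom f he.idem g x).symm.trans
      ((congrArg _ (congrArg _ hxy)).trans (coeffHat_val_cornerAlgHom f he.idem g y))
  · intro t
    let x : CrossedProduct (cornerCocycle f he.idem) :=
      (Finsupp.equivFunOnFinite.symm fun g : MulAction.stabilizer G e =>
        IsIdempotentElem.Corner.compress he.idem (coeffHat _ f (g : G) t.val) :
        MulAction.stabilizer G e →₀ he.idem.Corner)
    refine ⟨x, IsIdempotentElem.Corner.val_injective _ ?_⟩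
    rw [← sum_singleHat_coeffHat (maximalIdeal R) (cornerAlgHom f he.idem x).val,
      ← sum_singleHat_coeffHat (maximalIdeal R) t.val]
    refine Finset.sum_congr rfl fun g _ => congrArg _ ?_
    by_cases hg : g • e = e
    · refine (coeffHat_val_cornerAlgHom f he.idem ⟨g, hg⟩ x).trans ?_
      change e * coeffHat _ f g t.val * e = _
      conv_rhs => rw [coeffHat_val_eq, hg]
    · have h0 : e * g • e = 0 := he.mul_eq_zero (he.smul g) (Ne.symm hg)
      have h1 (u : TCorner f he.idem) : coeffHat _ f g u.val = 0 := by
        rw [coeffHat_val_eq, mul_right_comm, h0, zero_mul]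
      rw [h1, h1]

/-- The idempotent `e` is full in `T̂`: each conjugate `g • e` is `U_g e U_g⁻¹`, and the orbit sums
to `1`. -/
theorem exists_sum_mul_idempotent_mul_eq_one [Algebra.IsInvariant R S G]
    (he : IsPrimitiveIdempotent e) :
    ∃ (s : Finset (SHat R S)) (x y : SHat R S → THat R f),
      ∑ i ∈ s, x i * sHatToTHat R f e * y i = 1 := by
  -- Each orbit element gets a group element that carries `e` to it; off the orbit the value `1` is
  -- a filler.
  have hg (i : SHat R S) : ∃ g : G,
      i ∈ (Set.finite_range fun g : G => g • e).toFinset → g • e = i := by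
    by_cases hi : i ∈ (Set.finite_range fun g : G => g • e).toFinset
    · obtain ⟨g, hg⟩ := (Set.Finite.mem_toFinset _).1 hi
      exact ⟨g, fun _ => hg⟩
    · exact ⟨1, fun h => absurd h hi⟩
  choose γ hγ using hg
  choose y hy using exists_singleHat_mul_eq (f := f) (maximalIdeal R)
  refine ⟨(Set.finite_range fun g : G => g • e).toFinset, fun i => singleHat _ f (γ i) 1, fun i => y (γ i), ?_⟩
  refine Eq.trans ?_ ((congrArg (sHatToTHat R f) (sum_orbit_eq_one G he)).trans (map_one _))
  rw [map_sum]
  refine Finset.sum_congr rfl fun i hi => ?_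
  simp only [singleHat_mul_map_coeffHom, one_mul, hy, hγ i hi]

end Corner

/-! ### Corners as algebras over the base ring: finiteness and torsion-freeness -/

namespace IsIdempotentElem.Corner

variable {R B : Type*} [CommRing R] [Ring B] [Algebra R B] {e : B} (he : IsIdempotentElem e)

theorem val_algebraMap (r : R) : (algebraMap R he.Corner r).val = algebraMap R B r * e := by
  rw [← Algebra.smul_def]
  rfl

instance [Module.Finite R B] : Module.Finite R he.Corner := by
  let π : B →ₗ[R] he.Corner :=
    { toFun := compress he
      map_add' := compress_add he
      map_smul' := fun r b => val_injective he (by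
        change e * (r • b) * e = r • (e * b * e)
        rw [mul_smul_comm, smul_mul_assoc]) }
  exact Module.Finite.of_surjective π fun x => ⟨x.val, compress_val he x⟩

instance [Module.IsTorsionFree R B] : Module.IsTorsionFree R he.Corner :=
  Function.Injective.moduleIsTorsionFree val (val_injective he) fun _ _ => rfl

end IsIdempotentElem.Corner

/-! ## The crossed product as an order -/

section Order

variable {R S G L : Type*} [CommRing R] [CommRing S] [Algebra R S] [Group G]
  [MulSemiringAction G S] [SMulCommClass G R S]

theorem mapAlgHom_single {S' : Type*} [CommRing S'] [MulSemiringAction G S'] [Algebra R S']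
    [SMulCommClass G R S'] (f : TwoCocycle G S) (φ : S →ₐ[R] S')
    (hφ : ∀ (g : G) (s : S), (φ : S →+* S') (g • s) = g • (φ : S →+* S') s) (g : G) (s : S) :
    CrossedProduct.mapAlgHom f φ hφ (CrossedProduct.single f g s) =
      CrossedProduct.single _ g (φ s) :=
  Finsupp.mapRange_single (hf := map_zero φ)

theorem mapAlgHom_injective {S' : Type*} [CommRing S'] [MulSemiringAction G S'] [Algebra R S']
    [SMulCommClass G R S'] (f : TwoCocycle G S) (φ : S →ₐ[R] S')
    (hφ : ∀ (g : G) (s : S), (φ : S →+* S') (g • s) = g • (φ : S →+* S') s)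
    (hinj : Function.Injective φ) : Function.Injective (CrossedProduct.mapAlgHom f φ hφ) := by
  intro x y hxy
  refine Finsupp.ext fun g => hinj ?_
  exact congrArg (CrossedProduct.coeff _ g) hxy

/-- Denominators can be taken in `R`: a nonzero element of `S` is integral over `R`, hence divides a
nonzero element of `R`. -/
theorem exists_ne_zero_smul_eq_algebraMap [IsDomain R] [IsDomain S] [Algebra.IsIntegral R S]
    [FaithfulSMul R S] [Field L] [Algebra S L] [IsFractionRing S L] [Algebra R L]
    [IsScalarTower R S L] (l : L) : ∃ r : R, r ≠ 0 ∧ ∃ s : S, r • l = algebraMap S L s := by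
  obtain ⟨⟨a, b⟩, hab⟩ := IsLocalization.surj (nonZeroDivisors S) l
  obtain ⟨r, hr, hrb⟩ := (Algebra.IsIntegral.isIntegral (R := R) (b : S)).isAlgebraic
    |>.exists_nonzero_dvd b.2
  obtain ⟨c, hc⟩ := hrb
  refine ⟨r, hr, a * c, ?_⟩
  rw [Algebra.smul_def, IsScalarTower.algebraMap_apply R S L, hc, map_mul, map_mul, ← hab]
  ring

/-- The criterion applies since `T` is a full lattice in `L^f * G`: the finitely many coefficients
of an element have a common denominator in `R`. -/
theorem isMaximalOrderIn_crossedProductOrder_iff [IsDomain R] [IsDiscreteValuationRing R]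
    [IsDomain S] [FaithfulSMul R S] [Module.Finite R S] [Finite G]
    {K : Type*} [Field K] [Algebra R K] [IsFractionRing R K]
    [Field L] [Algebra S L] [IsFractionRing S L] [Algebra R L] [IsScalarTower R S L]
    [Algebra K L] [IsScalarTower R K L]
    [MulSemiringAction G L] [SMulDistribClass G S L] [SMulCommClass G R L] [SMulCommClass G K L]
    {ϖ : R} (hϖ : Irreducible ϖ) (f : TwoCocycle G S) :
    IsMaximalOrderIn R K (crossedProductOrder R L f) ↔
      NoProperOverring (algebraMap R (CrossedProduct f) ϖ) := by
  refine isMaximalOrderIn_range_iff hϖ _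
    (mapAlgHom_injective _ _ _ (IsFractionRing.injective S L)) fun a => ?_
  induction a using CrossedProduct.induction_on with
  | zero => exact ⟨1, one_ne_zero, 0, by simp⟩
  | single g l =>
    obtain ⟨r, hr, s, hs⟩ := exists_ne_zero_smul_eq_algebraMap (R := R) (S := S) l
    refine ⟨r, hr, CrossedProduct.single f g s, ?_⟩
    exact ((CrossedProduct.smul_single r g l).trans (congrArg _ hs)).trans
      (mapAlgHom_single f (IsScalarTower.toAlgHom R S L)
        (fun g s => algebraMap.smul' g s L) g s).symm
  | add a b ha hb =>
    obtain ⟨r, hr, x, hx⟩ := ha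
    obtain ⟨s, hs, y, hy⟩ := hb
    refine ⟨r * s, mul_ne_zero hr hs, s • x + r • y, ?_⟩
    rw [smul_add, map_add, map_smul, map_smul, ← hx, ← hy, smul_smul, smul_smul, mul_comm s r]

end Order

end

/-! ### The main theorem -/

theorem mainTheorem5
    {S : Type*} [CommRing S] [IsDedekindDomain S]
    {G : Type*} [Group G] [Finite G] [MulSemiringAction G S] [FaithfulSMul G S]
    -- `R = S^G` is a discrete valuation ring
    {R : Type*} [CommRing R] [IsDomain R] [IsDiscreteValuationRing R] [Algebra R S]
    [FaithfulSMul R S] [SMulCommClass G R S] [Algebra.IsInvariant R S G]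
    -- `S/R` is residually separable
    (hsep : ∀ (P : Ideal S) [P.IsMaximal] [P.LiesOver (IsLocalRing.maximalIdeal R)],
      Algebra.IsSeparable (R ⧸ IsLocalRing.maximalIdeal R) (S ⧸ P))
    -- `K` and `L` are the fields of fractions of `R` and `S`, with the induced action of `G`
    {K : Type*} [Field K] [Algebra R K] [IsFractionRing R K]
    {L : Type*} [Field L] [Algebra S L] [IsFractionRing S L] [Algebra R L] [IsScalarTower R S L]
    [Algebra K L] [IsScalarTower R K L]
    [MulSemiringAction G L] [SMulDistribClass G S L] [SMulCommClass G R L] [SMulCommClass G K L]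
    (f : TwoCocycle G S)
    -- a primitive idempotent of the completion of `S`
    (e : SHat R S) (he : IsPrimitiveIdempotent e) :
    List.TFAE
      [IsMaximalOrderIn R K (crossedProductOrder R L f),
        IsMaximalOrder (RHat R) (THat R f),
        IsMaximalOrder (RHat R) (TCorner f he.idem)] ∧
    ((maximalTwoSidedIdeals (CrossedProduct f)).Finite ∧
      (maximalTwoSidedIdeals (CrossedProduct f)).encard =
        (maximalTwoSidedIdeals (THat R f)).encard ∧
      (maximalTwoSidedIdeals (THat R f)).encard =
        (maximalTwoSidedIdeals (TCorner f he.idem)).encard) ∧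
    -- `e T̂ e` is the crossed product of `G₁` over `Ŝ e`
    (∃ φ : CrossedProduct (cornerCocycle f he.idem) ≃ₐ[RHat R] TCorner f he.idem,
      ∀ (g : MulAction.stabilizer G e) (s : he.idem.Corner),
        (φ (CrossedProduct.single _ g s)).val =
          sHatToTHat R f s.val *
            AlgCompletion.of (IsLocalRing.maximalIdeal R) (CrossedProduct f)
              (CrossedProduct.single f (g : G) 1)) := by
  obtain ⟨ϖ, hϖ⟩ := IsDiscreteValuationRing.exists_irreducible R
  have hϖ' := AdicCompletion.irreducible_algebraMap hϖ
  -- Finiteness of `S` over `R`: the extension `L/K` is finite Galois with group `G`, hence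
  -- separable, and `S` is the integral closure of `R` in `L`.
  have : IsGaloisGroup G R S := ⟨inferInstance, inferInstance, inferInstance⟩
  have : Algebra.IsIntegral R S := Algebra.IsInvariant.isIntegral R S G
  have : IsGaloisGroup G K L := IsGaloisGroup.to_isFractionRing G R S K L
  have : IsGalois K L := IsGaloisGroup.isGalois G K L
  have : FiniteDimensional K L := IsGaloisGroup.finiteDimensional G K L
  have : IsIntegralClosure S R L := IsIntegralClosure.of_isIntegrallyClosed S R L
  have : Module.Finite R S := IsIntegralClosure.finite R K L S
  obtain ⟨s, x, y, hfull⟩ := exists_sum_mul_idempotent_mul_eq_one f he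
  refine ⟨?_, ⟨finite_maximalTwoSidedIdeals R, AlgCompletion.encard_maximalTwoSidedIdeals R _,
    IsIdempotentElem.Corner.encard_maximalTwoSidedIdeals _ hfull⟩,
    AlgEquiv.ofBijective (cornerAlgHom f he.idem) (cornerAlgHom_bijective f he), fun g s => ?_⟩
  · have h12 : IsMaximalOrderIn R K (crossedProductOrder R L f) ↔
        IsMaximalOrder (RHat R) (THat R f) := by
      rw [isMaximalOrderIn_crossedProductOrder_iff hϖ, isMaximalOrder_iff hϖ',
        AlgCompletion.noProperOverring_iff _ hϖ]
    have h23 : IsMaximalOrder (RHat R) (THat R f) ↔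
        IsMaximalOrder (RHat R) (TCorner f he.idem) := by
      rw [isMaximalOrder_iff hϖ', isMaximalOrder_iff hϖ']
      exact IsIdempotentElem.Corner.noProperOverring_iff _ hfull (Algebra.commutes _)
        (IsIdempotentElem.Corner.val_algebraMap _ _)
    tfae_have 1 ↔ 2 := h12
    tfae_have 2 ↔ 3 := h23
    tfae_finish
  · rw [← CrossedProduct.singleHat_of, CrossedProduct.map_coeffHom_mul_singleHat, map_one, mul_one]
    exact congrArg _ (cornerAlgHom_single f he.idem g s)
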